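/- **Definitions.** A function $\varphi:\mathbb R\to[0,\infty)$ is *strongly convex* if it is convex, nondecreasing and $\lim_{t\to\infty}\varphi(t)/t=\infty$; put $\varphi(-\infty)=0$ and $\Phi=\varphi\circ\log$ on $[0,\infty)$. Let $m$ be normalized Lebesgue measure on the unit circle $\mathbb T$, let $\mathbb D$ be the open unit disc, and let $\log_+=\max(0,\log)$. For $f$ holomorphic on $\mathbb D$ write $f(\zeta)$, $\zeta\in\mathbb T$, for its nontangential boundary values. The Nevanlinna class $N$ consists of the holomorphic $f$ on $\mathbb D$ with $\sup_{0<r<1}\int_{\mathbb T}\log_+|f(r\zeta)|\,dm(\zeta)<\infty$ (these have nontangential boundary values a.e.), and the Smirnov class is $$N^+=\Big\{f\in N:\ \sup_{0<r<1}\int_{\mathbb T}\log_+|f(r\zeta)|\,dm(\zeta)=\int_{\mathbb T}\log_+|f(\zeta)|\,dm(\zeta)\Big\}.$$ The Hardy–Orlicz class is $\mathcal H_\Phi=\{f\in N^+:\int_{\mathbb T}\Phi(|f(\zeta)|)\,dm(\zeta)<\infty\}$; for $\varphi(t)=e^{pt}$, $p>0$, it is the Hardy space $H^p$. For a class $X$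 of holomorphic functions on $\mathbb D$, $\operatorname{Alg}(X)$ is the complex algebra of functions generated by $X$, and $\operatorname{Mult}(X)=\{g \text{ holomorphic on }\mathbb D: gf\in X \text{ for all } f\in X\}$. Let $\log_k$ be the $k$-fold iterate of $\log$. Say that a strictly increasing strongly convex function $\varphi$ has *property (G)* if the numbers $t_n$ with $\varphi(t_n)=2^n$ (defined for all large $n$) satisfy $t_{n+1}-t_n\to\infty$ as $n\to\infty$. **Corollary 5.1.** 1. Let $\varphi$ be a strictly increasing strongly convex function with property (G), and $\Phi=\varphi\circ\log$. Then there is a strongly convex function $\psi$ such that, with $\Psi=\psi\circ\log$, $$\operatorname{Alg}(\mathcal H_\Psi)\subset\operatorname{Mult}(\mathcal H_\Phi).$$ 2. Let $k\ge 1$ be an integer. There is a strictly increasing strongly convex function $\varphi$ with $\varphi(t)=e^{t/\log_k t}$ for all sufficiently large $t$. Every such $\varphi$ has property (G). Moreover, for every such $\varphi$, with $\Phi=\varphi\circ\log$, $$\bigcup_{p>0}H^p\subsetneq\mathcal H_\Phi,$$ and there is a strongly convex $\psi$ such that, with $\Psi=\psi\circ\log$, $\operatorname{Alg}(\mathcal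 H_\Psi)\subset\operatorname{Mult}(\mathcal H_\Phi)$ and $\mathcal H_\Psi$ contains an unbounded function. In particular $\mathcal H_\Phi$ has unbounded multipliers. -/

import Mathlib

open Set Filter Topology MeasureTheory
open scoped ENNReal Complex.UnitDisc

noncomputable section

namespace HardyOrlicz

/-- Normalized Lebesgue measure on the unit circle, in the parametrization `θ ↦ exp (i θ)`,
`0 < θ ≤ 2π`. Functions on the circle are accordingly written as functions of the angle `θ`. -/
def circleMeasure : Measure ℝ :=
  ENNReal.ofReal (1 / (2 * Real.pi)) • volume.restrict (Ioc 0 (2 * Real.pi))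

/-- A strongly convex function: `φ : ℝ → [0, ∞)` convex, nondecreasing, with `φ t / t → ∞` as
`t → ∞`. -/
structure StronglyConvex (φ : ℝ → ℝ) : Prop where
  nonneg : ∀ t, 0 ≤ φ t
  convexOn : ConvexOn ℝ univ φ
  monotone : Monotone φ
  tendsto : Tendsto (fun t => φ t / t) atTop atTop

/-- `Φ = φ ∘ log` on `[0, ∞)`, with the conventions `log 0 = -∞` and `φ (-∞) = 0`. -/
def compLog (φ : ℝ → ℝ) (s : ℝ) : ℝ :=
  if s = 0 then 0 else φ (Real.log s)

/-- The Orlicz class `L_Φ` on the circle, `Φ = φ ∘ log`: all measurable `u` for which the integral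
of `Φ(|u|)` is finite. -/
def orliczClass (φ : ℝ → ℝ) : Set (ℝ → ℂ) :=
  {u | AEMeasurable u circleMeasure ∧
    ∫⁻ θ, ENNReal.ofReal (compLog φ ‖u θ‖) ∂circleMeasure < ∞}

/-- Holomorphic functions on the open unit disc. -/
def IsHolomorphic (f : 𝔻 → ℂ) : Prop :=
  ∃ F : ℂ → ℂ, DifferentiableOn ℂ F (Metric.ball 0 1) ∧ ∀ z : 𝔻, f z = F z

/-- The nontangential approach region (Stolz angle) of aperture `a` at `ζ`. -/
def stolzRegion (a : ℝ) (ζ : Circle) : Set 𝔻 :=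
  {z | ‖(z : ℂ) - (ζ : ℂ)‖ < a * (1 - ‖(z : ℂ)‖)}

/-- `f` has the nontangential limit `w` at the boundary point `ζ`: it tends to `w` as `z → ζ`
within every Stolz angle at `ζ`. -/
def HasNontangentialLimit (f : 𝔻 → ℂ) (ζ : Circle) (w : ℂ) : Prop :=
  ∀ a : ℝ, 1 < a →
    Tendsto f (comap (fun z : 𝔻 => (z : ℂ)) (𝓝 (ζ : ℂ)) ⊓ 𝓟 (stolzRegion a ζ)) (𝓝 w)

/-- `u` is (up to null sets) the boundary function of `f`: for almost every `θ`, `f` has the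
nontangential limit `u θ` at `exp (i θ)`. -/
def IsBoundaryFunction (f : 𝔻 → ℂ) (u : ℝ → ℂ) : Prop :=
  ∀ᵐ θ ∂circleMeasure, HasNontangentialLimit f (Circle.exp θ) (u θ)

/-- The point `r ζ` of the disc, for `0 < r < 1` and `|ζ| = 1`. -/
def radialPoint (r : Ioo (0 : ℝ) 1) (ζ : Circle) : 𝔻 :=
  Complex.UnitDisc.mk ((r : ℝ) * (ζ : ℂ)) (by
    rw [norm_mul, Circle.norm_coe, mul_one, Complex.norm_real, Real.norm_eq_abs,
      abs_of_pos r.2.1]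
    exact r.2.2)

/-- The supremum over `0 < r < 1` of the means of `log₊ |f|` over the circles of radius `r`. -/
def logMeanSup (f : 𝔻 → ℂ) : ℝ≥0∞ :=
  ⨆ r : Ioo (0 : ℝ) 1,
    ∫⁻ θ, ENNReal.ofReal (Real.posLog ‖f (radialPoint r (Circle.exp θ))‖) ∂circleMeasure

/-- The Nevanlinna class `N` of the disc. -/
def nevanlinnaClass : Set (𝔻 → ℂ) :=
  {f | IsHolomorphic f ∧ logMeanSup f < ∞}

/-- The Smirnov class `N⁺`: those `f` in `N` for which the supremum of the means of `log₊ |f|` is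
the mean of `log₊ |u|`, where `u` is the nontangential boundary function of `f` (which is unique up
to null sets, and exists for each `f` in `N`). -/
def smirnovClass : Set (𝔻 → ℂ) :=
  {f | f ∈ nevanlinnaClass ∧ ∃ u : ℝ → ℂ, IsBoundaryFunction f u ∧
    logMeanSup f = ∫⁻ θ, ENNReal.ofReal (Real.posLog ‖u θ‖) ∂circleMeasure}

/-- The Hardy-Orlicz class `H_Φ`, `Φ = φ ∘ log`: the functions in `N⁺` whose boundary function is in
the Orlicz class `L_Φ`. -/
def hardyOrlicz (φ : ℝ → ℝ) : Set (𝔻 → ℂ) :=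
  {f | f ∈ smirnovClass ∧ ∃ u : ℝ → ℂ, IsBoundaryFunction f u ∧ u ∈ orliczClass φ}

/-- The Hardy space `H^p`, as the Hardy-Orlicz class with `φ t = exp (p t)`, that is
`Φ s = s ^ p`. -/
def hardySpace (p : ℝ) : Set (𝔻 → ℂ) :=
  hardyOrlicz fun t => Real.exp (p * t)

/-- The multipliers of a class `X` of functions on the disc: holomorphic `g` with `g X ⊆ X`. -/
def multipliers (X : Set (𝔻 → ℂ)) : Set (𝔻 → ℂ) :=
  {g | IsHolomorphic g ∧ ∀ f ∈ X, g * f ∈ X}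

/-- The algebra of functions on the disc generated by `X`. -/
def generatedAlgebra (X : Set (𝔻 → ℂ)) : Set (𝔻 → ℂ) :=
  (Algebra.adjoin ℂ X : Subalgebra ℂ (𝔻 → ℂ))

/-- The numbers `t n` with `φ (t n) = 2 ^ n` (which exist and are unique for all large `n` when `φ`
is strictly increasing, continuous and unbounded) have gaps `t (n + 1) - t n` tending to
infinity. -/
def HasDyadicGaps (φ : ℝ → ℝ) : Prop :=
  ∃ t : ℕ → ℝ, (∀ᶠ n in atTop, φ (t n) = 2 ^ n) ∧
    Tendsto (fun n => t (n + 1) - t n) atTop atTop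

/-- The iterated logarithm `log_k` (meaningful for large arguments). -/
def iterLog (k : ℕ) (t : ℝ) : ℝ := Real.log^[k] t

/-- `φ` is a strictly increasing strongly convex function which is `exp (t / log_k t)` for all
large `t`. -/
def IsExpDivIterLog (k : ℕ) (φ : ℝ → ℝ) : Prop :=
  StronglyConvex φ ∧ StrictMono φ ∧
    ∀ᶠ t in atTop, φ t = Real.exp (t / iterLog k t)

end HardyOrlicz

end

namespace HardyOrlicz

/-! Property (G) is a doubling condition for every translation: for each `C`, `φ (t + C) ≤ 4 * φ t`
once `t` is large (`HasDyadicGaps.exists_forall_add_le`). Let `T n` be the threshold for `C = n +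
1`. Add to `φ` a convex function that is at least `φ (T n + n + 1)` on `[n, ∞)`, and call the sum
`ψ`. For `n ≤ log |b| < n + 1`, either `log |a| ≥ T n` and doubling bounds `Φ(|ab|)` by `4 Φ(|a|)`,
or `Ψ(|b|)` alone bounds it (`HasDyadicGaps.exists_mul_compLog_le`). So `H_Ψ` multiplies `H_Φ` into
itself. Taking `C = log 2` shows that `H_Φ` is closed under sums, hence its multipliers form an
algebra, which contains the one generated by `H_Ψ`.

The Smirnov class must also be closed under sums and products. The means of `log₊ |f|` increase with
the radius (`IsHolomorphic.monotone_logMean`), so their supremum is a limit along a sequence of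
radii, and a Fatou lemma with convergent majorants applies (`mem_smirnovClass_of_dominated`).

For `φ t = exp (t / log_k t)`, equating values at consecutive `t n` gives gaps of at least `log 2 *
log_k (t n)`. The special functions are built in `w = 1 / (1 - z)`, which maps the disc into the
right half-plane, with rapidly decreasing `ε n`. The sum of `ε n * w / (1 + ε n * w)` is unbounded
but grows as slowly as desired (`StronglyConvex.exists_unbounded`). The product of `1 + ε n * w`
outgrows every power of `w`, yet is slow enough for `H_Φ` when `φ` is below every exponential
(`StronglyConvex.exists_notMem_hardySpace`). -/

/-! ### Subharmonicity of `log₊ |G|` by entire majorants. -/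

/-- A trigonometric polynomial is the sum of an entire function and the conjugate of an entire
function on the circle. -/
theorem exists_entire_of_mem_span_fourier [Fact (0 < 2 * Real.pi)]
    {p : C(AddCircle (2 * Real.pi), ℂ)}
    (hp : p ∈ Submodule.span ℂ (range (fourier (T := 2 * Real.pi)))) :
    ∃ P Q : ℂ → ℂ, Differentiable ℂ P ∧ Differentiable ℂ Q ∧ ∀ x : AddCircle (2 * Real.pi),
      p x = P (AddCircle.toCircle x) + (starRingEnd ℂ) (Q (AddCircle.toCircle x)) := by
  induction hp using Submodule.span_induction with
  | mem p hp =>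
    obtain ⟨n, rfl⟩ := hp
    obtain ⟨m, rfl | rfl⟩ := n.eq_nat_or_neg
    · refine ⟨fun z => z ^ m, fun _ => 0, by fun_prop, by fun_prop, fun x => ?_⟩
      rw [fourier_apply, AddCircle.toCircle_zsmul]
      simp
    · refine ⟨fun _ => 0, fun z => z ^ m, by fun_prop, by fun_prop, fun x => ?_⟩
      rw [fourier_neg, fourier_apply, AddCircle.toCircle_zsmul]
      simp
  | zero => exact ⟨fun _ => 0, fun _ => 0, by fun_prop, by fun_prop, by simp⟩
  | add p q _ _ hp hq =>
    obtain ⟨P, Q, hP, hQ, h⟩ := hp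
    obtain ⟨P', Q', hP', hQ', h'⟩ := hq
    refine ⟨fun z => P z + P' z, fun z => Q z + Q' z, by fun_prop, by fun_prop, fun x => ?_⟩
    simp only [ContinuousMap.add_apply, h, h', map_add]
    ring
  | smul c p _ hp =>
    obtain ⟨P, Q, hP, hQ, h⟩ := hp
    refine ⟨fun z => c * P z, fun z => (starRingEnd ℂ) c * Q z, by fun_prop, by fun_prop,
      fun x => ?_⟩
    simp only [ContinuousMap.smul_apply, h, map_mul, smul_eq_mul, Complex.conj_conj]
    ring

/-- A continuous real function on the unit circle is approximated from above by real parts of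
entire functions. -/
theorem exists_entire_re_approx {h : ℂ → ℝ} (hh : ContinuousOn h (Metric.sphere 0 1))
    {ε : ℝ} (hε : 0 < ε) :
    ∃ P : ℂ → ℂ, Differentiable ℂ P ∧ ∀ z ∈ Metric.sphere (0 : ℂ) 1,
      h z ≤ (P z).re ∧ (P z).re ≤ h z + ε := by
  have : Fact (0 < 2 * Real.pi) := ⟨Real.two_pi_pos⟩
  have hc : Continuous fun x : AddCircle (2 * Real.pi) => h (AddCircle.toCircle x) :=
    hh.comp_continuous (continuous_subtype_val.comp AddCircle.continuous_toCircle)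
      fun x => mem_sphere_zero_iff_norm.2 (Circle.norm_coe _)
  -- The shift by `ε / 2` turns a two-sided approximation within `ε / 2` into a bound from above.
  let H : C(AddCircle (2 * Real.pi), ℂ) :=
    ⟨fun x => ((h (AddCircle.toCircle x) + ε / 2 : ℝ) : ℂ),
      Complex.continuous_ofReal.comp (hc.add continuous_const)⟩
  have hH : H ∈ (Submodule.span ℂ (range (fourier (T := 2 * Real.pi)))).topologicalClosure := by
    rw [span_fourier_closure_eq_top]; trivial
  obtain ⟨p, hp, hpd⟩ := Metric.mem_closure_iff.1 hH (ε / 2) (half_pos hε)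
  obtain ⟨P, Q, hP, hQ, hpq⟩ := exists_entire_of_mem_span_fourier hp
  -- Only real parts matter, so the conjugate of `Q` can be replaced by `Q` itself.
  refine ⟨fun z => P z + Q z, by fun_prop, fun z hz => ?_⟩
  obtain ⟨θ, hθ⟩ : ∃ θ : ℝ, ((Circle.exp θ : Circle) : ℂ) = z := by
    refine ⟨Complex.arg z, ?_⟩
    rw [Circle.coe_exp]
    have := Complex.norm_mul_exp_arg_mul_I z
    rw [mem_sphere_zero_iff_norm.1 hz] at this
    simpa using this
  have hx : ((AddCircle.toCircle (θ : AddCircle (2 * Real.pi)) : Circle) : ℂ) = z := by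
    rw [← hθ, AddCircle.toCircle_apply_mk, div_self Real.two_pi_pos.ne', one_mul]
  have hd : dist (H θ) (p θ) < ε / 2 := (ContinuousMap.dist_apply_le_dist _).trans_lt hpd
  rw [hpq, dist_eq_norm] at hd
  have hre := (Complex.abs_re_le_norm _).trans_lt hd
  simp only [H, ContinuousMap.coe_mk, hx, Complex.sub_re, Complex.add_re, Complex.conj_re,
    Complex.ofReal_re] at hre
  rw [abs_lt] at hre
  simp only [Complex.add_re]
  constructor <;> linarith

/-- On the unit circle, approximate `log₊ |G|` from above by `Re P` with `P` entire. The maximum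
principle for `exp (-P)` and `G * exp (-P)` carries the majorization into the disc. The mean of `Re
P` is the same over all circles about `0`, and the approximation error is arbitrary. -/
theorem circleAverage_posLog_norm_le {G : ℂ → ℂ} (hG : DiffContOnCl ℂ G (Metric.ball 0 1))
    {ρ : ℝ} (hρ : 0 < ρ) (hρ1 : ρ ≤ 1) :
    Real.circleAverage (fun z => Real.posLog ‖G z‖) 0 ρ ≤
      Real.circleAverage (fun z => Real.posLog ‖G z‖) 0 1 := by
  have hcl : closure (Metric.ball (0 : ℂ) 1) = Metric.closedBall 0 1 :=
    closure_ball _ one_ne_zero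
  have hcont : ContinuousOn (fun z => Real.posLog ‖G z‖) (Metric.closedBall 0 1) := by
    rw [← hcl]
    exact Real.continuous_posLog.comp_continuousOn hG.continuousOn.norm
  have hint : ∀ r : ℝ, 0 < r → r ≤ 1 → CircleIntegrable (fun z => Real.posLog ‖G z‖) 0 r := by
    intro r hr hr1
    refine ContinuousOn.circleIntegrable hr.le (hcont.mono ?_)
    exact Metric.sphere_subset_closedBall.trans (Metric.closedBall_subset_closedBall hr1)
  refine le_of_forall_pos_le_add fun ε hε => ?_
  obtain ⟨P, hP, hPb⟩ := exists_entire_re_approx (hcont.mono Metric.sphere_subset_closedBall) hε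
  have hPd : ∀ r : ℝ, DiffContOnCl ℂ P (Metric.ball 0 r) := fun r => hP.diffContOnCl
  have hPint : ∀ r : ℝ, CircleIntegrable (fun z => (P z).re) 0 r := fun r =>
    (Complex.continuous_re.comp hP.continuous).continuousOn.circleIntegrable'
  have hmean : ∀ r : ℝ, Real.circleAverage (fun z => (P z).re) 0 r = (P 0).re := by
    intro r
    have h1 := (hPd |r|).circleAverage
    have h2 := Complex.reCLM.circleAverage_comp_comm (f := P) (c := 0) (R := r)
      hP.continuous.continuousOn.circleIntegrable'
    rw [h1] at h2
    exact h2
  have hE : DiffContOnCl ℂ (fun z => Complex.exp (-P z)) (Metric.ball 0 1) :=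
    (Complex.differentiable_exp.comp hP.neg).diffContOnCl
  have hnorm : ∀ z, ‖Complex.exp (-P z)‖ = Real.exp (-(P z).re) := fun z => by
    rw [Complex.norm_exp]; simp
  have hfr : frontier (Metric.ball (0 : ℂ) 1) = Metric.sphere 0 1 :=
    frontier_ball _ one_ne_zero
  have hb1 : ∀ z ∈ Metric.closedBall (0 : ℂ) 1, 0 ≤ (P z).re := by
    intro z hz
    have := Complex.norm_le_of_forall_mem_frontier_norm_le Metric.isBounded_ball hE (C := 1)
      (fun w hw => by
        rw [hfr] at hw
        rw [hnorm]
        have := (hPb w hw).1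
        have h0 : 0 ≤ Real.posLog ‖G w‖ := Real.posLog_nonneg
        exact Real.exp_le_one_iff.2 (by linarith)) (hcl ▸ hz)
    rw [hnorm, Real.exp_le_one_iff] at this
    linarith
  have hb2 : ∀ z ∈ Metric.closedBall (0 : ℂ) 1, Real.posLog ‖G z‖ ≤ (P z).re := by
    intro z hz
    have := Complex.norm_le_of_forall_mem_frontier_norm_le Metric.isBounded_ball (hG.smul hE)
      (C := 1) (fun w hw => by
        rw [hfr] at hw
        have h1 := (hPb w hw).1
        have h2 : Real.log ‖G w‖ ≤ (P w).re := (le_max_right _ _).trans h1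
        simp only [norm_smul, hnorm]
        rw [Real.exp_neg, ← div_eq_mul_inv, div_le_one (Real.exp_pos _)]
        rcases (norm_nonneg (G w)).eq_or_lt with h | h
        · rw [← h]; positivity
        · exact (Real.log_le_iff_le_exp h).1 h2) (hcl ▸ hz)
    simp only [norm_smul, hnorm] at this
    rw [Real.exp_neg, ← div_eq_mul_inv, div_le_one (Real.exp_pos _)] at this
    refine max_le (hb1 z hz) ?_
    rcases (norm_nonneg (G z)).eq_or_lt with h | h
    · rw [← h, Real.log_zero]; exact hb1 z hz
    · exact (Real.log_le_iff_le_exp h).2 this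
  calc Real.circleAverage (fun z => Real.posLog ‖G z‖) 0 ρ
      ≤ Real.circleAverage (fun z => (P z).re) 0 ρ := by
        refine Real.circleAverage_mono (hint ρ hρ hρ1) (hPint ρ) fun z hz => hb2 z ?_
        rw [abs_of_pos hρ] at hz
        exact Metric.closedBall_subset_closedBall hρ1 (Metric.sphere_subset_closedBall hz)
    _ = Real.circleAverage (fun z => (P z).re) 0 1 := by rw [hmean, hmean]
    _ ≤ Real.circleAverage (fun z => Real.posLog ‖G z‖ + ε) 0 1 := by
        refine Real.circleAverage_mono (hPint 1)
          ((hint 1 one_pos le_rfl).add (continuousOn_const.circleIntegrable')) fun z hz => ?_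
        rw [abs_one] at hz
        exact (hPb z hz).2
    _ = Real.circleAverage (fun z => Real.posLog ‖G z‖) 0 1 + ε := by
        rw [Real.circleAverage_fun_add (hint 1 one_pos le_rfl)
          (continuousOn_const.circleIntegrable'), Real.circleAverage_const]

/-! ### Radial means and nontangential boundary functions. -/

instance : IsProbabilityMeasure circleMeasure := by
  refine ⟨?_⟩
  have h := Real.two_pi_pos
  rw [circleMeasure, Measure.smul_apply, Measure.restrict_apply_univ, Real.volume_Ioc, sub_zero,
    smul_eq_mul, ← ENNReal.ofReal_mul (by positivity), one_div, inv_mul_cancel₀ h.ne',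
    ENNReal.ofReal_one]

theorem lintegral_circleMeasure_eq_circleAverage {f : ℂ → ℝ} {r : ℝ} (h0 : ∀ z, 0 ≤ f z)
    (hf : CircleIntegrable f 0 r) :
    ∫⁻ θ, ENNReal.ofReal (f (r * (Circle.exp θ : ℂ))) ∂circleMeasure =
      ENNReal.ofReal (Real.circleAverage f 0 r) := by
  have hp := Real.two_pi_pos
  have hi : IntegrableOn (fun θ => f (circleMap 0 r θ)) (Ioc 0 (2 * Real.pi)) := by
    have h := hf
    unfold CircleIntegrable at h
    rwa [intervalIntegrable_iff_integrableOn_Ioc_of_le hp.le] at h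
  rw [circleMeasure, lintegral_smul_measure, Real.circleAverage_def,
    intervalIntegral.integral_of_le hp.le, smul_eq_mul, smul_eq_mul,
    ENNReal.ofReal_mul (by positivity), one_div,
    ofReal_integral_eq_lintegral_ofReal hi (Eventually.of_forall fun θ => h0 _)]
  simp [circleMap, Circle.coe_exp]

theorem IsHolomorphic.mul {f g : 𝔻 → ℂ} (hf : IsHolomorphic f) (hg : IsHolomorphic g) :
    IsHolomorphic (f * g) := by
  obtain ⟨F, hF, h⟩ := hf
  obtain ⟨G, hG, h'⟩ := hg
  exact ⟨fun z => F z * G z, hF.mul hG, fun z => by simp [h, h']⟩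

theorem IsHolomorphic.add {f g : 𝔻 → ℂ} (hf : IsHolomorphic f) (hg : IsHolomorphic g) :
    IsHolomorphic (f + g) := by
  obtain ⟨F, hF, h⟩ := hf
  obtain ⟨G, hG, h'⟩ := hg
  exact ⟨fun z => F z + G z, hF.add hG, fun z => by simp [h, h']⟩

theorem IsHolomorphic.continuous {f : 𝔻 → ℂ} (hf : IsHolomorphic f) : Continuous f := by
  obtain ⟨F, hF, h⟩ := hf
  have : f = fun z : 𝔻 => F z := funext h
  rw [this]
  exact hF.continuousOn.comp_continuous Complex.UnitDisc.continuous_coe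
    fun z => mem_ball_zero_iff.2 z.norm_lt_one

@[simp] theorem coe_radialPoint (r : Ioo (0 : ℝ) 1) (ζ : Circle) :
    ((radialPoint r ζ : 𝔻) : ℂ) = (r : ℝ) * (ζ : ℂ) := rfl

theorem norm_radialPoint (r : Ioo (0 : ℝ) 1) (ζ : Circle) : ‖((radialPoint r ζ : 𝔻) : ℂ)‖ = r := by
  rw [coe_radialPoint, norm_mul, Circle.norm_coe, mul_one, Complex.norm_real, Real.norm_eq_abs,
    abs_of_pos r.2.1]

/-- The mean of `log₊ |f|` over the circle of radius `r`. -/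
noncomputable def logMean (f : 𝔻 → ℂ) (r : Ioo (0 : ℝ) 1) : ℝ≥0∞ :=
  ∫⁻ θ, ENNReal.ofReal (Real.posLog ‖f (radialPoint r (Circle.exp θ))‖) ∂circleMeasure

/-- Dilation by the larger radius `s` gives a function continuous up to the unit circle; the circle
of radius `r` becomes that of radius `r / s ≤ 1`. -/
theorem IsHolomorphic.monotone_logMean {f : 𝔻 → ℂ} (hf : IsHolomorphic f) :
    Monotone (logMean f) := by
  obtain ⟨F, hF, h⟩ := hf
  intro r s hrs
  have hr := r.2
  have hs := s.2
  have hG : DiffContOnCl ℂ (fun z => F ((s : ℝ) * z)) (Metric.ball 0 1) := by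
    refine DifferentiableOn.diffContOnCl_ball (U := Metric.closedBall 0 1) ?_ le_rfl
    refine hF.comp (by fun_prop) fun z hz => ?_
    rw [mem_closedBall_zero_iff] at hz
    rw [mem_ball_zero_iff, norm_mul, Complex.norm_real, Real.norm_of_nonneg hs.1.le]
    nlinarith [hs.1, hs.2]
  have hcont : ContinuousOn (fun z => Real.posLog ‖F ((s : ℝ) * z)‖) (Metric.closedBall 0 1) := by
    rw [← closure_ball _ one_ne_zero]
    exact Real.continuous_posLog.comp_continuousOn hG.continuousOn.norm
  have key : ∀ ρ : ℝ, 0 < ρ → ρ ≤ 1 →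
      CircleIntegrable (fun z => Real.posLog ‖F ((s : ℝ) * z)‖) 0 ρ := fun ρ h0 h1 =>
    ContinuousOn.circleIntegrable h0.le (hcont.mono
      (Metric.sphere_subset_closedBall.trans (Metric.closedBall_subset_closedBall h1)))
  have hρ : 0 < (r : ℝ) / s := div_pos hr.1 hs.1
  have hρ1 : (r : ℝ) / s ≤ 1 := (div_le_one hs.1).2 hrs
  have e1 := lintegral_circleMeasure_eq_circleAverage
    (f := fun z => Real.posLog ‖F ((s : ℝ) * z)‖) (fun z => Real.posLog_nonneg) (key _ hρ hρ1)
  have e2 := lintegral_circleMeasure_eq_circleAverage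
    (f := fun z => Real.posLog ‖F ((s : ℝ) * z)‖) (fun z => Real.posLog_nonneg)
    (key _ one_pos le_rfl)
  have hs0 : ((s : ℝ) : ℂ) ≠ 0 := by exact_mod_cast hs.1.ne'
  have m1 : logMean f r = ENNReal.ofReal (Real.circleAverage
      (fun z => Real.posLog ‖F ((s : ℝ) * z)‖) 0 ((r : ℝ) / s)) := by
    rw [← e1, logMean]
    refine lintegral_congr fun θ => ?_
    rw [h, coe_radialPoint, Complex.ofReal_div, ← mul_assoc, mul_div_cancel₀ _ hs0]
  have m2 : logMean f s = ENNReal.ofReal (Real.circleAverage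
      (fun z => Real.posLog ‖F ((s : ℝ) * z)‖) 0 1) := by
    rw [← e2, logMean]
    refine lintegral_congr fun θ => ?_
    rw [h, coe_radialPoint, Complex.ofReal_one, one_mul]
  rw [m1, m2]
  exact ENNReal.ofReal_le_ofReal (circleAverage_posLog_norm_le hG hρ hρ1)

/-- A sequence of radii increasing to `1`. -/
noncomputable def radius (n : ℕ) : Ioo (0 : ℝ) 1 :=
  ⟨1 - 1 / (n + 2), by
    have : (0 : ℝ) < n + 2 := by positivity
    constructor
    · rw [sub_pos, div_lt_one this]; linarith [(n.cast_nonneg : (0 : ℝ) ≤ n)]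
    · linarith [one_div_pos.2 this]⟩

theorem coe_radius (n : ℕ) : (radius n : ℝ) = 1 - 1 / (n + 2) := rfl

theorem tendsto_radius : Tendsto (fun n => (radius n : ℝ)) atTop (𝓝 1) := by
  have h : Tendsto (fun n : ℕ => (1 : ℝ) / ((n + 1 : ℕ) + 1)) atTop (𝓝 0) :=
    (tendsto_add_atTop_iff_nat 1).2 (tendsto_one_div_add_atTop_nhds_zero_nat (𝕜 := ℝ))
  have h2 := (tendsto_const_nhds (x := (1 : ℝ))).sub h
  rw [sub_zero] at h2
  refine h2.congr fun n => ?_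
  rw [coe_radius]; push_cast; ring

/-- Monotonicity turns the supremum over all radii into a limit along one sequence, where
convergence theorems can be used. -/
theorem IsHolomorphic.tendsto_logMean {f : 𝔻 → ℂ} (hf : IsHolomorphic f) :
    Tendsto (fun n => logMean f (radius n)) atTop (𝓝 (logMeanSup f)) := by
  have hmono : Monotone radius := by
    intro m n hmn
    have : (m : ℝ) ≤ n := by exact_mod_cast hmn
    change (radius m : ℝ) ≤ radius n
    rw [coe_radius, coe_radius]
    gcongr
  have : logMeanSup f = ⨆ n, logMean f (radius n) := by
    refine le_antisymm (iSup_le fun r => ?_) (iSup_le fun n => le_iSup (logMean f) (radius n))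
    obtain ⟨n, hn⟩ := (tendsto_radius.eventually (lt_mem_nhds r.2.2)).exists
    exact (hf.monotone_logMean (show r ≤ radius n from hn.le)).trans
      (le_iSup (fun n => logMean f (radius n)) n)
  rw [this]
  exact tendsto_atTop_iSup (hf.monotone_logMean.comp hmono)

theorem tendsto_radialPoint (ζ : Circle) {a : ℝ} (ha : 1 < a) :
    Tendsto (fun n => radialPoint (radius n) ζ) atTop
      (comap (fun z : 𝔻 => (z : ℂ)) (𝓝 (ζ : ℂ)) ⊓ 𝓟 (stolzRegion a ζ)) := by
  rw [tendsto_inf]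
  constructor
  · rw [tendsto_comap_iff]
    have : Tendsto (fun n => ((radius n : ℝ) : ℂ) * (ζ : ℂ)) atTop (𝓝 (((1 : ℝ) : ℂ) * ζ)) :=
      ((Complex.continuous_ofReal.tendsto 1).comp tendsto_radius).mul_const _
    rwa [Complex.ofReal_one, one_mul] at this
  · rw [tendsto_principal]
    refine Eventually.of_forall fun n => ?_
    have h := (radius n).2
    have : ((radius n : ℝ) : ℂ) * (ζ : ℂ) - ζ = ((radius n - 1 : ℝ) : ℂ) * ζ := by
      push_cast; ring
    rw [stolzRegion, mem_ofPred_eq, norm_radialPoint, coe_radialPoint, this, norm_mul,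
      Circle.norm_coe, mul_one, Complex.norm_real, Real.norm_eq_abs, abs_sub_comm,
      abs_of_pos (sub_pos.2 h.2)]
    nlinarith [h.2]

theorem HasNontangentialLimit.tendsto_radial {f : 𝔻 → ℂ} {ζ : Circle} {w : ℂ}
    (h : HasNontangentialLimit f ζ w) :
    Tendsto (fun n => f (radialPoint (radius n) ζ)) atTop (𝓝 w) :=
  (h 2 one_lt_two).comp (tendsto_radialPoint ζ one_lt_two)

theorem IsBoundaryFunction.ae_eq {f : 𝔻 → ℂ} {u v : ℝ → ℂ} (hu : IsBoundaryFunction f u)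
    (hv : IsBoundaryFunction f v) : u =ᵐ[circleMeasure] v := by
  filter_upwards [hu, hv] with θ h1 h2
  exact tendsto_nhds_unique h1.tendsto_radial h2.tendsto_radial

theorem IsBoundaryFunction.mul {f g : 𝔻 → ℂ} {u v : ℝ → ℂ} (hu : IsBoundaryFunction f u)
    (hv : IsBoundaryFunction g v) : IsBoundaryFunction (f * g) (u * v) := by
  filter_upwards [hu, hv] with θ h1 h2
  exact fun a ha => (h1 a ha).mul (h2 a ha)

theorem IsBoundaryFunction.add {f g : 𝔻 → ℂ} {u v : ℝ → ℂ} (hu : IsBoundaryFunction f u)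
    (hv : IsBoundaryFunction g v) : IsBoundaryFunction (f + g) (u + v) := by
  filter_upwards [hu, hv] with θ h1 h2
  exact fun a ha => (h1 a ha).add (h2 a ha)

theorem continuous_radialPoint (r : Ioo (0 : ℝ) 1) :
    Continuous fun θ : ℝ => radialPoint r (Circle.exp θ) := by
  refine Complex.UnitDisc.isEmbedding_coe.continuous_iff.2 ?_
  change Continuous fun θ : ℝ => ((r : ℝ) : ℂ) * (Circle.exp θ : ℂ)
  exact continuous_const.mul (continuous_subtype_val.comp Circle.exp.continuous)

theorem IsBoundaryFunction.aemeasurable {f : 𝔻 → ℂ} {u : ℝ → ℂ} (hf : IsHolomorphic f)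
    (hu : IsBoundaryFunction f u) : AEMeasurable u circleMeasure := by
  refine aemeasurable_of_tendsto_metrizable_ae atTop
    (f := fun n θ => f (radialPoint (radius n) (Circle.exp θ))) (fun n => ?_) ?_
  · exact (hf.continuous.comp (continuous_radialPoint _)).aemeasurable
  · filter_upwards [hu] with θ h using h.tendsto_radial

/-! ### Closure of the Smirnov class under sums and products. -/

/-- The mean of `log₊ |u|` over the circle. -/
noncomputable def boundaryLogMean (u : ℝ → ℂ) : ℝ≥0∞ :=
  ∫⁻ θ, ENNReal.ofReal (Real.posLog ‖u θ‖) ∂circleMeasure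

theorem continuous_ofReal_posLog_norm :
    Continuous fun w : ℂ => ENNReal.ofReal (Real.posLog ‖w‖) :=
  ENNReal.continuous_ofReal.comp (Real.continuous_posLog.comp continuous_norm)

/-- Fatou's lemma with a convergent sequence of majorants. -/
theorem le_lintegral_of_tendsto_of_dominated {α : Type*} [MeasurableSpace α] {μ : Measure α}
    {X G : ℕ → α → ℝ≥0∞} {x g : α → ℝ≥0∞} {L : ℝ≥0∞}
    (hXm : ∀ n, AEMeasurable (X n) μ) (hGm : ∀ n, AEMeasurable (G n) μ)
    (hxm : AEMeasurable x μ)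
    (hXG : ∀ n, X n ≤ᵐ[μ] G n) (hX : ∀ᵐ a ∂μ, Tendsto (fun n => X n a) atTop (𝓝 (x a)))
    (hG : ∀ᵐ a ∂μ, Tendsto (fun n => G n a) atTop (𝓝 (g a)))
    (hL : Tendsto (fun n => ∫⁻ a, X n a ∂μ) atTop (𝓝 L))
    (hGi : Tendsto (fun n => ∫⁻ a, G n a ∂μ) atTop (𝓝 (∫⁻ a, g a ∂μ)))
    (hg : ∫⁻ a, g a ∂μ ≠ ∞) : L ≤ ∫⁻ a, x a ∂μ := by
  have hxg : x ≤ᵐ[μ] g := by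
    filter_upwards [ae_all_iff.2 hXG, hX, hG] with a h1 h2 h3
    exact le_of_tendsto_of_tendsto' h2 h3 h1
  have hgm : AEMeasurable g μ := aemeasurable_of_tendsto_metrizable_ae atTop hGm hG
  have hgfin : ∀ᵐ a ∂μ, g a ≠ ∞ := by
    filter_upwards [ae_lt_top' hgm hg] with a h using h.ne
  have hxfin : ∫⁻ a, x a ∂μ ≠ ∞ := ne_top_of_le_ne_top hg (lintegral_mono_ae hxg)
  have hLg : L ≤ ∫⁻ a, g a ∂μ :=
    le_of_tendsto_of_tendsto' hL hGi fun n => lintegral_mono_ae (hXG n)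
  have hLfin : L ≠ ∞ := ne_top_of_le_ne_top hg hLg
  -- Fatou is applied to the nonnegative differences `G n - X n`; finiteness of the integral of `g`
  -- then allows cancellation.
  have hF : ∫⁻ a, (g a - x a) ∂μ ≤ liminf (fun n => ∫⁻ a, (G n a - X n a) ∂μ) atTop := by
    refine le_trans (lintegral_mono_ae ?_)
      (lintegral_liminf_le' (f := fun n a => G n a - X n a) fun n => (hGm n).sub (hXm n))
    filter_upwards [hX, hG, hgfin] with a h1 h2 h3
    exact (ENNReal.Tendsto.sub h2 h1 (Or.inl h3)).liminf_eq.ge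
  have hlim : Tendsto (fun n => ∫⁻ a, (G n a - X n a) ∂μ) atTop (𝓝 (∫⁻ a, g a ∂μ - L)) := by
    refine (ENNReal.Tendsto.sub hGi hL (Or.inl hg)).congr' ?_
    have hev : ∀ᶠ n in atTop, ∫⁻ a, X n a ∂μ < ∞ := hL.eventually (gt_mem_nhds hLfin.lt_top)
    filter_upwards [hev] with n hn
    exact (lintegral_sub' (hXm n) hn.ne (hXG n)).symm
  rw [hlim.liminf_eq, lintegral_sub' hxm hxfin hxg] at hF
  have h1 : ∫⁻ a, x a ∂μ ≤ ∫⁻ a, g a ∂μ := lintegral_mono_ae hxg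
  have h2 := tsub_le_iff_right.1 hF
  have h3 : ∫⁻ a, g a ∂μ - L + L = ∫⁻ a, g a ∂μ := tsub_add_cancel_of_le hLg
  have h4 : ∫⁻ a, g a ∂μ - L ≠ ∞ := ne_top_of_le_ne_top hg tsub_le_self
  refine (ENNReal.add_le_add_iff_left h4).1 ?_
  rw [h3]
  exact h2

theorem IsBoundaryFunction.tendsto_ofReal_posLog {f : 𝔻 → ℂ} {u : ℝ → ℂ}
    (hu : IsBoundaryFunction f u) : ∀ᵐ θ ∂circleMeasure,
      Tendsto (fun n => ENNReal.ofReal (Real.posLog ‖f (radialPoint (radius n) (Circle.exp θ))‖))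
        atTop (𝓝 (ENNReal.ofReal (Real.posLog ‖u θ‖))) := by
  filter_upwards [hu] with θ h
  exact (continuous_ofReal_posLog_norm.tendsto _).comp h.tendsto_radial

theorem IsHolomorphic.aemeasurable_posLog {f : 𝔻 → ℂ} (hf : IsHolomorphic f)
    (r : Ioo (0 : ℝ) 1) :
    AEMeasurable (fun θ => ENNReal.ofReal (Real.posLog ‖f (radialPoint r (Circle.exp θ))‖))
      circleMeasure :=
  (continuous_ofReal_posLog_norm.comp
    (hf.continuous.comp (continuous_radialPoint r))).aemeasurable

/-- This half of the Smirnov equality is Fatou's lemma and costs nothing; only the reverse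
inequality needs domination. -/
theorem IsBoundaryFunction.boundaryLogMean_le {f : 𝔻 → ℂ} {u : ℝ → ℂ} (hf : IsHolomorphic f)
    (hu : IsBoundaryFunction f u) : boundaryLogMean u ≤ logMeanSup f := by
  rw [← hf.tendsto_logMean.liminf_eq]
  refine le_trans (lintegral_mono_ae ?_) (lintegral_liminf_le' fun n => hf.aemeasurable_posLog _)
  filter_upwards [hu.tendsto_ofReal_posLog] with θ h using h.liminf_eq.ge

/-- A criterion for membership in the Smirnov class: the functions `log₊ |f|` on the circles of
radius `radius n` have a sequence of majorants which converges almost everywhere and in mean. -/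
theorem mem_smirnovClass_of_dominated {f : 𝔻 → ℂ} {u : ℝ → ℂ} (hf : IsHolomorphic f)
    (hu : IsBoundaryFunction f u) {G : ℕ → ℝ → ℝ≥0∞} {g : ℝ → ℝ≥0∞}
    (hGm : ∀ n, AEMeasurable (G n) circleMeasure)
    (hfG : ∀ n, ∀ᵐ θ ∂circleMeasure,
      ENNReal.ofReal (Real.posLog ‖f (radialPoint (radius n) (Circle.exp θ))‖) ≤ G n θ)
    (hG : ∀ᵐ θ ∂circleMeasure, Tendsto (fun n => G n θ) atTop (𝓝 (g θ)))
    (hGi : Tendsto (fun n => ∫⁻ θ, G n θ ∂circleMeasure) atTop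
      (𝓝 (∫⁻ θ, g θ ∂circleMeasure)))
    (hg : ∫⁻ θ, g θ ∂circleMeasure ≠ ∞) : f ∈ smirnovClass := by
  have h1 : logMeanSup f ≤ boundaryLogMean u :=
    le_lintegral_of_tendsto_of_dominated (fun n => hf.aemeasurable_posLog (radius n)) hGm
      (continuous_ofReal_posLog_norm.measurable.comp_aemeasurable (hu.aemeasurable hf))
      hfG hu.tendsto_ofReal_posLog hG hf.tendsto_logMean hGi hg
  have h2 : logMeanSup f ≤ ∫⁻ θ, g θ ∂circleMeasure :=
    le_of_tendsto_of_tendsto' hf.tendsto_logMean hGi fun n => lintegral_mono_ae (hfG n)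
  exact ⟨⟨hf, h2.trans_lt hg.lt_top⟩, u, hu, h1.antisymm (hu.boundaryLogMean_le hf)⟩

/-- Boundary functions are unique almost everywhere, so the Smirnov equality holds for any choice of
`u`. This supplies convergence in mean for the majorants below. -/
theorem tendsto_logMean_of_mem_smirnovClass {f : 𝔻 → ℂ} (hf : f ∈ smirnovClass) {u : ℝ → ℂ}
    (hu : IsBoundaryFunction f u) :
    Tendsto (fun n => logMean f (radius n)) atTop (𝓝 (boundaryLogMean u)) ∧
      boundaryLogMean u ≠ ∞ := by
  obtain ⟨⟨hh, hN⟩, v, hv, h⟩ := hf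
  have e : boundaryLogMean u = logMeanSup f := by
    rw [h]
    refine lintegral_congr_ae ?_
    filter_upwards [hu.ae_eq hv] with θ hθ
    rw [hθ]
  rw [e]
  exact ⟨hh.tendsto_logMean, hN.ne⟩

/-- The right-hand sides on the circles serve as majorants: they converge almost everywhere and in
mean because `f` and `g` are Smirnov. Products use `c = 0`, sums `c = log 2`. -/
theorem mem_smirnovClass_of_posLog_le {f g h : 𝔻 → ℂ} {u v w : ℝ → ℂ} (hf : f ∈ smirnovClass)
    (hg : g ∈ smirnovClass) (hu : IsBoundaryFunction f u) (hv : IsBoundaryFunction g v)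
    (hh : IsHolomorphic h) (hw : IsBoundaryFunction h w) {c : ℝ} (hc : 0 ≤ c)
    (hle : ∀ z, Real.posLog ‖h z‖ ≤ Real.posLog ‖f z‖ + Real.posLog ‖g z‖ + c) :
    h ∈ smirnovClass := by
  obtain ⟨hf1, hf2⟩ := tendsto_logMean_of_mem_smirnovClass hf hu
  obtain ⟨hg1, hg2⟩ := tendsto_logMean_of_mem_smirnovClass hg hv
  have mu : AEMeasurable (fun θ => ENNReal.ofReal (Real.posLog ‖u θ‖)) circleMeasure :=
    continuous_ofReal_posLog_norm.measurable.comp_aemeasurable (hu.aemeasurable hf.1.1)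
  have mv : AEMeasurable (fun θ => ENNReal.ofReal (Real.posLog ‖v θ‖)) circleMeasure :=
    continuous_ofReal_posLog_norm.measurable.comp_aemeasurable (hv.aemeasurable hg.1.1)
  have hgi : ∫⁻ θ, (ENNReal.ofReal (Real.posLog ‖u θ‖) + ENNReal.ofReal (Real.posLog ‖v θ‖)
      + ENNReal.ofReal c) ∂circleMeasure =
      boundaryLogMean u + boundaryLogMean v + ENNReal.ofReal c := by
    rw [lintegral_add_right' _ aemeasurable_const, lintegral_add_left' mu, lintegral_const,
      measure_univ, mul_one]
    rfl
  refine mem_smirnovClass_of_dominated hh hw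
    (G := fun n θ => ENNReal.ofReal (Real.posLog ‖f (radialPoint (radius n) (Circle.exp θ))‖) +
      ENNReal.ofReal (Real.posLog ‖g (radialPoint (radius n) (Circle.exp θ))‖) + ENNReal.ofReal c)
    (g := fun θ => ENNReal.ofReal (Real.posLog ‖u θ‖) + ENNReal.ofReal (Real.posLog ‖v θ‖)
      + ENNReal.ofReal c) (fun n => ?_) (fun n => ?_) ?_ ?_ ?_
  · exact ((hf.1.1.aemeasurable_posLog _).add (hg.1.1.aemeasurable_posLog _)).add
      aemeasurable_const
  · refine Eventually.of_forall fun θ => ?_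
    rw [← ENNReal.ofReal_add Real.posLog_nonneg Real.posLog_nonneg,
      ← ENNReal.ofReal_add (add_nonneg Real.posLog_nonneg Real.posLog_nonneg) hc]
    exact ENNReal.ofReal_le_ofReal (hle _)
  · filter_upwards [hu.tendsto_ofReal_posLog, hv.tendsto_ofReal_posLog] with θ h1 h2
    exact (h1.add h2).add tendsto_const_nhds
  · rw [hgi]
    refine ((hf1.add hg1).add (tendsto_const_nhds (x := ENNReal.ofReal c))).congr fun n => ?_
    rw [lintegral_add_right' _ aemeasurable_const,
      lintegral_add_left' (hf.1.1.aemeasurable_posLog _), lintegral_const, measure_univ, mul_one]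
    rfl
  · rw [hgi]
    exact ENNReal.add_ne_top.2 ⟨ENNReal.add_ne_top.2 ⟨hf2, hg2⟩, ENNReal.ofReal_ne_top⟩

theorem mul_mem_smirnovClass {f g : 𝔻 → ℂ} (hf : f ∈ smirnovClass) (hg : g ∈ smirnovClass) :
    f * g ∈ smirnovClass := by
  obtain ⟨u, hu, -⟩ := hf.2
  obtain ⟨v, hv, -⟩ := hg.2
  refine mem_smirnovClass_of_posLog_le hf hg hu hv (hf.1.1.mul hg.1.1) (hu.mul hv) le_rfl
    fun z => ?_
  rw [Pi.mul_apply, norm_mul, add_zero]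
  exact Real.posLog_mul

theorem add_mem_smirnovClass {f g : 𝔻 → ℂ} (hf : f ∈ smirnovClass) (hg : g ∈ smirnovClass) :
    f + g ∈ smirnovClass := by
  obtain ⟨u, hu, -⟩ := hf.2
  obtain ⟨v, hv, -⟩ := hg.2
  refine mem_smirnovClass_of_posLog_le hf hg hu hv (hf.1.1.add hg.1.1) (hu.add hv)
    (Real.log_nonneg one_le_two) fun z => ?_
  rw [Pi.add_apply]
  have := Real.posLog_norm_add_le (f z) (g z)
  linarith

theorem const_mem_smirnovClass (c : ℂ) : (fun _ => c : 𝔻 → ℂ) ∈ smirnovClass := by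
  refine mem_smirnovClass_of_dominated (u := fun _ => c)
    (G := fun _ _ => ENNReal.ofReal (Real.posLog ‖c‖)) ⟨fun _ => c, by fun_prop, fun _ => rfl⟩
    (Eventually.of_forall fun θ a _ => tendsto_const_nhds) (fun _ => aemeasurable_const)
    (fun _ => Eventually.of_forall fun _ => le_rfl)
    (Eventually.of_forall fun _ => tendsto_const_nhds) tendsto_const_nhds ?_
  rw [lintegral_const, measure_univ, mul_one]
  exact ENNReal.ofReal_ne_top

/-! ### Orlicz estimates from property (G), and the algebra of multipliers. -/

theorem StronglyConvex.compLog_nonneg {φ : ℝ → ℝ} (hφ : StronglyConvex φ) (s : ℝ) :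
    0 ≤ compLog φ s := by
  unfold compLog
  split_ifs
  exacts [le_rfl, hφ.nonneg _]

theorem compLog_zero (φ : ℝ → ℝ) : compLog φ 0 = 0 := if_pos rfl

theorem compLog_of_ne {φ : ℝ → ℝ} {s : ℝ} (hs : s ≠ 0) : compLog φ s = φ (Real.log s) := if_neg hs

theorem StronglyConvex.measurable_compLog {φ : ℝ → ℝ} (hφ : StronglyConvex φ) :
    Measurable (compLog φ) :=
  Measurable.ite (measurableSet_singleton 0) measurable_const
    (hφ.monotone.measurable.comp Real.measurable_log)

theorem mem_orliczClass_of_le {φ ψ χ : ℝ → ℝ} (hφ : StronglyConvex φ) (hψ : StronglyConvex ψ)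
    {u v w : ℝ → ℂ} (hu : u ∈ orliczClass φ) (hv : v ∈ orliczClass ψ)
    (hw : AEMeasurable w circleMeasure) {c K : ℝ} (hc : 0 ≤ c) (hK : 0 ≤ K)
    (h : ∀ θ, compLog χ ‖w θ‖ ≤ c * (compLog φ ‖u θ‖ + compLog ψ ‖v θ‖) + K) :
    w ∈ orliczClass χ := by
  refine ⟨hw, ?_⟩
  have mu : AEMeasurable (fun θ => ENNReal.ofReal (compLog φ ‖u θ‖)) circleMeasure :=
    (ENNReal.measurable_ofReal.comp hφ.measurable_compLog).comp_aemeasurable hu.1.norm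
  have hle : ∫⁻ θ, ENNReal.ofReal (compLog χ ‖w θ‖) ∂circleMeasure ≤
      ∫⁻ θ, (ENNReal.ofReal c * (ENNReal.ofReal (compLog φ ‖u θ‖) +
        ENNReal.ofReal (compLog ψ ‖v θ‖)) + ENNReal.ofReal K) ∂circleMeasure := by
    refine lintegral_mono fun θ => ?_
    have h1 := hφ.compLog_nonneg ‖u θ‖
    have h2 := hψ.compLog_nonneg ‖v θ‖
    rw [← ENNReal.ofReal_add h1 h2, ← ENNReal.ofReal_mul hc,
      ← ENNReal.ofReal_add (mul_nonneg hc (add_nonneg h1 h2)) hK]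
    exact ENNReal.ofReal_le_ofReal (h θ)
  refine hle.trans_lt ?_
  rw [lintegral_add_right' _ aemeasurable_const, lintegral_const_mul' _ _ ENNReal.ofReal_ne_top,
    lintegral_add_left' mu, lintegral_const, measure_univ, mul_one]
  exact ENNReal.add_lt_top.2 ⟨ENNReal.mul_lt_top ENNReal.ofReal_lt_top
    (ENNReal.add_lt_top.2 ⟨hu.2, hv.2⟩), ENNReal.ofReal_lt_top⟩

/-- Dyadic gaps tending to infinity give a doubling condition for all translations. -/
theorem HasDyadicGaps.exists_forall_add_le {φ : ℝ → ℝ} (hm : StrictMono φ)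
    (hG : HasDyadicGaps φ) (C : ℝ) : ∃ T, ∀ t, T ≤ t → φ (t + C) ≤ 4 * φ t := by
  obtain ⟨t, ht, hgap⟩ := hG
  obtain ⟨N, hN⟩ := eventually_atTop.1 (ht.and (hgap.eventually_ge_atTop C))
  refine ⟨t N, fun x hx => ?_⟩
  have hx1 : 2 ^ N ≤ φ x := (hN N le_rfl).1 ▸ hm.monotone hx
  obtain ⟨n, hn1, hn2⟩ := exists_nat_pow_near ((one_le_pow₀ one_le_two).trans hx1)
    (one_lt_two (α := ℝ))
  have hNn : N ≤ n := by
    by_contra! hlt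
    have : (2 : ℝ) ^ (n + 1) ≤ 2 ^ N := pow_le_pow_right₀ one_le_two hlt
    linarith
  have h1 : x < t (n + 1) := by
    rw [← hm.lt_iff_lt, (hN (n + 1) (by omega)).1]
    exact hn2
  have h2 := (hN (n + 1) (by omega)).2
  have h3 := (hN (n + 1 + 1) (by omega)).1
  -- The point `x` lies below `t (n + 1)`, and the next gap absorbs `C`. Two dyadic levels above `2
  -- ^ n ≤ φ x` account for the factor `4`.
  calc φ (x + C) ≤ φ (t (n + 1 + 1)) := hm.monotone (by linarith)
    _ = 4 * 2 ^ n := by rw [h3]; ring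
    _ ≤ 4 * φ x := by linarith

/-- A convex, nondecreasing function dominating prescribed values. -/
theorem exists_convexOn_monotone_ge (c : ℕ → ℝ) (hc : ∀ n, 0 ≤ c n) :
    ∃ S : ℝ → ℝ, (∀ t, 0 ≤ S t) ∧ ConvexOn ℝ univ S ∧ Monotone S ∧
      ∀ n : ℕ, ∀ t : ℝ, n ≤ t → c n ≤ S t := by
  have hs : ∀ t : ℝ, Summable fun n : ℕ => c n * max 0 (t + 1 - n) := by
    intro t
    obtain ⟨N, hN⟩ := exists_nat_ge (t + 1)
    refine summable_of_hasFiniteSupport ((finite_lt_nat N).subset fun n hn => ?_)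
    by_contra hnN
    have : (N : ℝ) ≤ n := by exact_mod_cast not_lt.1 hnN
    exact hn (by simp only []; rw [max_eq_left (by linarith), mul_zero])
  have h0 : ∀ (t : ℝ) (n : ℕ), 0 ≤ c n * max 0 (t + 1 - n) := fun t n =>
    mul_nonneg (hc n) (le_max_left _ _)
  -- A sum of hinges, finite at each point: the `n`-th vanishes for `t ≤ n - 1` and has factor at
  -- least `1` for `t ≥ n`.
  refine ⟨fun t => ∑' n : ℕ, c n * max 0 (t + 1 - n), fun t => tsum_nonneg (h0 t),
    ⟨convex_univ, ?_⟩, ?_, ?_⟩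
  · intro x _ y _ a b ha hb hab
    simp only [smul_eq_mul]
    rw [← tsum_mul_left, ← tsum_mul_left, ← ((hs x).mul_left a).tsum_add ((hs y).mul_left b)]
    refine (hs _).tsum_le_tsum (fun n => ?_) (((hs x).mul_left a).add ((hs y).mul_left b))
    have : max 0 (a * x + b * y + 1 - n) ≤
        a * max 0 (x + 1 - n) + b * max 0 (y + 1 - n) := by
      refine max_le (by positivity) ?_
      have h1 := mul_le_mul_of_nonneg_left (le_max_right 0 (x + 1 - n)) ha
      have h2 := mul_le_mul_of_nonneg_left (le_max_right 0 (y + 1 - n)) hb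
      have h3 : a * x + b * y + 1 - n = a * (x + 1 - n) + b * (y + 1 - n) := by
        linear_combination (n - 1) * hab
      linarith
    nlinarith [mul_le_mul_of_nonneg_left this (hc n)]
  · intro x y hxy
    refine (hs x).tsum_le_tsum (fun n => ?_) (hs y)
    exact mul_le_mul_of_nonneg_left (max_le_max le_rfl (by linarith)) (hc n)
  · intro n t hnt
    refine le_trans ?_ ((hs t).le_tsum n fun m _ => h0 t m)
    refine le_mul_of_one_le_right (hc n) (le_max_of_le_right (by linarith))

/-- With `n` the integer part of `log |b| ≥ 0`, the factor `b` translates `log |a|` by less than `n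
+ 1`. Beyond `T n` doubling absorbs this; below `T n` the value is at most `φ (T n + n + 1)`, which
`S` was chosen to dominate. If `|b| ≤ 1`, monotonicity suffices. -/
theorem HasDyadicGaps.exists_mul_compLog_le {φ : ℝ → ℝ} (hφ : StronglyConvex φ)
    (hm : StrictMono φ) (hG : HasDyadicGaps φ) :
    ∃ ψ, StronglyConvex ψ ∧ ∀ a b : ℂ,
      compLog φ ‖b * a‖ ≤ 4 * (compLog φ ‖a‖ + compLog ψ ‖b‖) := by
  choose T hT using fun n : ℕ => hG.exists_forall_add_le hm ((n : ℝ) + 1)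
  obtain ⟨S, hS0, hSc, hSm, hS⟩ := exists_convexOn_monotone_ge (fun n : ℕ => φ (T n + (n + 1)))
    fun n => hφ.nonneg _
  have hψ : StronglyConvex fun t => φ t + S t := by
    refine ⟨fun t => add_nonneg (hφ.nonneg t) (hS0 t), hφ.convexOn.add hSc,
      hφ.monotone.add hSm, tendsto_atTop_mono' _ ?_ hφ.tendsto⟩
    filter_upwards [eventually_gt_atTop 0] with t ht
    exact div_le_div_of_nonneg_right (by linarith [hS0 t]) ht.le
  refine ⟨_, hψ, fun a b => ?_⟩
  have na := hφ.compLog_nonneg ‖a‖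
  have nb := hψ.compLog_nonneg ‖b‖
  rcases eq_or_ne (b * a) 0 with h | h
  · rw [h, norm_zero, compLog_zero]; positivity
  have hb : ‖b‖ ≠ 0 := norm_ne_zero_iff.2 (left_ne_zero_of_mul h)
  have ha : ‖a‖ ≠ 0 := norm_ne_zero_iff.2 (right_ne_zero_of_mul h)
  rw [compLog_of_ne (norm_ne_zero_iff.2 h), norm_mul, Real.log_mul hb ha]
  have ea : compLog φ ‖a‖ = φ (Real.log ‖a‖) := compLog_of_ne ha
  have eb : compLog (fun t => φ t + S t) ‖b‖ = φ (Real.log ‖b‖) + S (Real.log ‖b‖) :=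
    compLog_of_ne hb
  rcases le_total (Real.log ‖b‖) 0 with hlb | hlb
  · have : φ (Real.log ‖b‖ + Real.log ‖a‖) ≤ φ (Real.log ‖a‖) := hφ.monotone (by linarith)
    linarith
  · have f1 := Nat.floor_le hlb
    have f2 := Nat.lt_floor_add_one (Real.log ‖b‖)
    set n := ⌊Real.log ‖b‖⌋₊
    rcases le_total (T n) (Real.log ‖a‖) with hT' | hT'
    · have h1 := hT n _ hT'
      have : φ (Real.log ‖b‖ + Real.log ‖a‖) ≤ φ (Real.log ‖a‖ + (n + 1)) :=
        hφ.monotone (by linarith)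
      linarith
    · have h1 := hS n _ f1
      have : φ (Real.log ‖b‖ + Real.log ‖a‖) ≤ φ (T n + (n + 1)) := hφ.monotone (by linarith)
      have := hφ.nonneg (Real.log ‖b‖)
      linarith

/-- Since `|a + b|` is at most twice the larger modulus, this is doubling for the translation `log
2`; `K` covers arguments below the threshold. -/
theorem HasDyadicGaps.exists_compLog_add_le {φ : ℝ → ℝ} (hφ : StronglyConvex φ)
    (hm : StrictMono φ) (hG : HasDyadicGaps φ) :
    ∃ K, 0 ≤ K ∧ ∀ a b : ℂ, compLog φ ‖a + b‖ ≤ 4 * (compLog φ ‖a‖ + compLog φ ‖b‖) + K := by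
  obtain ⟨T, hT⟩ := hG.exists_forall_add_le hm (Real.log 2)
  have key : ∀ a b : ℂ, ‖b‖ ≤ ‖a‖ →
      compLog φ ‖a + b‖ ≤ 4 * compLog φ ‖a‖ + φ (T + Real.log 2) := by
    intro a b hab
    have na := hφ.compLog_nonneg ‖a‖
    have nT := hφ.nonneg (T + Real.log 2)
    rcases eq_or_ne (a + b) 0 with h | h
    · rw [h, norm_zero, compLog_zero]; positivity
    have h' : 0 < ‖a + b‖ := norm_pos_iff.2 h
    have h2 : ‖a + b‖ ≤ 2 * ‖a‖ := (norm_add_le a b).trans (by linarith)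
    have ha : 0 < ‖a‖ := by linarith
    have hl : Real.log ‖a + b‖ ≤ Real.log ‖a‖ + Real.log 2 := by
      rw [← Real.log_mul ha.ne' two_ne_zero, mul_comm]
      exact Real.log_le_log h' h2
    rw [compLog_of_ne h'.ne', compLog_of_ne ha.ne']
    rw [compLog_of_ne ha.ne'] at na
    rcases le_total T (Real.log ‖a‖) with hle | hle
    · have := hT _ hle
      have := hφ.monotone hl
      linarith
    · have : φ (Real.log ‖a + b‖) ≤ φ (T + Real.log 2) := hφ.monotone (by linarith)
      linarith
  refine ⟨φ (T + Real.log 2), hφ.nonneg _, fun a b => ?_⟩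
  have na := hφ.compLog_nonneg ‖a‖
  have nb := hφ.compLog_nonneg ‖b‖
  rcases le_total ‖b‖ ‖a‖ with h | h
  · linarith [key a b h]
  · rw [add_comm a b]
    linarith [key b a h]

theorem const_mem_hardyOrlicz (φ : ℝ → ℝ) (c : ℂ) : (fun _ => c : 𝔻 → ℂ) ∈ hardyOrlicz φ := by
  refine ⟨const_mem_smirnovClass c, fun _ => c,
    Eventually.of_forall fun θ a _ => tendsto_const_nhds, aemeasurable_const, ?_⟩
  rw [lintegral_const, measure_univ, mul_one]
  exact ENNReal.ofReal_lt_top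

/-- If `φ` has dyadic gaps tending to infinity, the algebra generated by some Hardy-Orlicz class
consists of multipliers of `H_Φ`. -/
theorem HasDyadicGaps.exists_generatedAlgebra_subset {φ : ℝ → ℝ} (hφ : StronglyConvex φ)
    (hm : StrictMono φ) (hG : HasDyadicGaps φ) :
    ∃ ψ, StronglyConvex ψ ∧
      generatedAlgebra (hardyOrlicz ψ) ⊆ multipliers (hardyOrlicz φ) := by
  obtain ⟨ψ, hψ, hle⟩ := hG.exists_mul_compLog_le hφ hm
  obtain ⟨K, hK, hadd⟩ := hG.exists_compLog_add_le hφ hm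
  have hmul : hardyOrlicz ψ ⊆ multipliers (hardyOrlicz φ) := by
    rintro g ⟨hg, v, hv, hvψ⟩
    refine ⟨hg.1.1, ?_⟩
    rintro f ⟨hf, u, hu, huφ⟩
    refine ⟨mul_mem_smirnovClass hg hf, v * u, hv.mul hu, ?_⟩
    refine mem_orliczClass_of_le hφ hψ huφ hvψ (hvψ.1.mul huφ.1) (c := 4) (K := 0) (by norm_num)
      le_rfl fun θ => ?_
    rw [add_zero]
    exact hle _ _
  have hsum : ∀ f ∈ hardyOrlicz φ, ∀ g ∈ hardyOrlicz φ, f + g ∈ hardyOrlicz φ := by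
    rintro f ⟨hf, u, hu, huφ⟩ g ⟨hg, v, hv, hvφ⟩
    exact ⟨add_mem_smirnovClass hf hg, u + v, hu.add hv,
      mem_orliczClass_of_le hφ hφ huφ hvφ (huφ.1.add hvφ.1) (by norm_num) hK fun θ => hadd _ _⟩
  refine ⟨ψ, hψ, fun g hg => ?_⟩
  -- Scalars need no separate argument, since constants already lie in `H_Ψ`. Additivity of `H_Φ` is
  -- what makes sums of multipliers multipliers.
  refine Algebra.adjoin_induction (p := fun g _ => g ∈ multipliers (hardyOrlicz φ))
    (fun g hg => hmul hg) (fun c => hmul (const_mem_hardyOrlicz ψ c)) ?_ ?_ hg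
  · intro g h _ _ hg hh
    refine ⟨hg.1.add hh.1, fun f hf => ?_⟩
    rw [add_mul]
    exact hsum _ (hg.2 f hf) _ (hh.2 f hf)
  · intro g h _ _ hg hh
    refine ⟨hg.1.mul hh.1, fun f hf => ?_⟩
    rw [mul_assoc]
    exact hg.2 _ (hh.2 f hf)

/-! ### Functions of `1 / (1 - z)` with a singularity only at `1`. -/

theorem ae_circleMeasure_mem_Ioo : ∀ᵐ θ ∂circleMeasure, θ ∈ Ioo 0 (2 * Real.pi) := by
  refine Measure.ae_smul_measure ?_ _
  rw [← restrict_Ioo_eq_restrict_Ioc]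
  exact ae_restrict_mem measurableSet_Ioo

theorem norm_one_sub_circleExp {θ : ℝ} (hθ : θ ∈ Icc 0 (2 * Real.pi)) :
    ‖1 - (Circle.exp θ : ℂ)‖ = 2 * Real.sin (θ / 2) := by
  rw [norm_sub_rev, Circle.coe_exp, mul_comm, Complex.norm_exp_I_mul_ofReal_sub_one,
    Real.norm_of_nonneg]
  exact mul_nonneg zero_le_two
    (Real.sin_nonneg_of_nonneg_of_le_pi (by linarith [hθ.1]) (by linarith [hθ.2]))

theorem norm_one_sub_circleExp_pos {θ : ℝ} (hθ : θ ∈ Ioo 0 (2 * Real.pi)) :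
    0 < ‖1 - (Circle.exp θ : ℂ)‖ := by
  rw [norm_one_sub_circleExp ⟨hθ.1.le, hθ.2.le⟩]
  exact mul_pos two_pos (Real.sin_pos_of_pos_of_lt_pi (by linarith [hθ.1]) (by linarith [hθ.2]))

/-- The modulus is `2 * sin (θ / 2)`, bounded below linearly by Jordan's inequality on `(0, π]` and
by reflection on the other half. Both endpoints represent the point `1`, hence two integrable
singularities. -/
theorem sqrt_inv_norm_one_sub_circleExp_le {θ : ℝ} (hθ : θ ∈ Ioo 0 (2 * Real.pi)) :
    √(‖1 - (Circle.exp θ : ℂ)‖⁻¹) ≤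
      2 * (θ ^ (-(1 / 2) : ℝ) + (2 * Real.pi - θ) ^ (-(1 / 2) : ℝ)) := by
  have hpi := Real.pi_pos
  have hpi4 := Real.pi_le_four
  have hs : ∀ x : ℝ, 0 < x → √(x⁻¹) = x ^ (-(1 / 2) : ℝ) := fun x hx => by
    rw [Real.sqrt_eq_rpow, Real.inv_rpow hx.le, ← Real.rpow_neg hx.le]
  have key : ∀ x : ℝ, 0 < x → x ≤ Real.pi → √((2 * Real.sin (x / 2))⁻¹) ≤
      2 * x ^ (-(1 / 2) : ℝ) := by
    intro x hx hx'
    have h1 := Real.mul_le_sin (x := x / 2) (by linarith) (by linarith)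
    have h2 : x / 4 ≤ 2 * Real.sin (x / 2) := by
      have : x / 4 ≤ 2 * (2 / Real.pi * (x / 2)) := by
        rw [show 2 * (2 / Real.pi * (x / 2)) = 2 * x / Real.pi by ring,
          div_le_div_iff₀ (by norm_num) hpi]
        nlinarith
      linarith
    calc √((2 * Real.sin (x / 2))⁻¹) ≤ √((x / 4)⁻¹) :=
          Real.sqrt_le_sqrt (inv_anti₀ (by positivity) h2)
      _ = √(2 ^ 2 * x⁻¹) := by congr 1; rw [inv_div, div_eq_mul_inv]; norm_num
      _ = 2 * x ^ (-(1 / 2) : ℝ) := by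
          rw [Real.sqrt_mul (by norm_num), Real.sqrt_sq zero_le_two, hs x hx]
  rw [norm_one_sub_circleExp ⟨hθ.1.le, hθ.2.le⟩]
  have p1 : 0 ≤ θ ^ (-(1 / 2) : ℝ) := Real.rpow_nonneg hθ.1.le _
  have p2 : 0 ≤ (2 * Real.pi - θ) ^ (-(1 / 2) : ℝ) := Real.rpow_nonneg (by linarith [hθ.2]) _
  rcases le_total θ Real.pi with h | h
  · linarith [key θ hθ.1 h]
  · have := key (2 * Real.pi - θ) (by linarith [hθ.2]) (by linarith)
    rw [show (2 * Real.pi - θ) / 2 = Real.pi - θ / 2 by ring, Real.sin_pi_sub] at this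
    linarith

theorem lintegral_sqrt_inv_norm_lt_top :
    ∫⁻ θ, ENNReal.ofReal √(‖1 - (Circle.exp θ : ℂ)‖⁻¹) ∂circleMeasure < ∞ := by
  have hp := Real.two_pi_pos
  have h1 : IntervalIntegrable (fun θ : ℝ => θ ^ (-(1 / 2) : ℝ)) volume 0 (2 * Real.pi) :=
    intervalIntegral.intervalIntegrable_rpow' (by norm_num)
  have h2 := (h1.comp_sub_left (2 * Real.pi)).symm
  rw [sub_zero, sub_self] at h2
  have h3 := (h1.add h2).const_mul 2
  rw [intervalIntegrable_iff_integrableOn_Ioc_of_le hp.le] at h3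
  have h4 := h3.lintegral_lt_top
  have h5 : ∫⁻ θ, ENNReal.ofReal √(‖1 - (Circle.exp θ : ℂ)‖⁻¹) ∂circleMeasure ≤
      ∫⁻ θ, ENNReal.ofReal (2 * (θ ^ (-(1 / 2) : ℝ) + (2 * Real.pi - θ) ^ (-(1 / 2) : ℝ)))
        ∂circleMeasure := by
    refine lintegral_mono_ae ?_
    filter_upwards [ae_circleMeasure_mem_Ioo] with θ hθ
    exact ENNReal.ofReal_le_ofReal (sqrt_inv_norm_one_sub_circleExp_le hθ)
  refine h5.trans_lt ?_
  rw [circleMeasure, lintegral_smul_measure, smul_eq_mul]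
  exact ENNReal.mul_lt_top ENNReal.ofReal_lt_top h4

theorem re_lt_one_of_norm_le_one {z : ℂ} (hz : ‖z‖ ≤ 1) (h1 : z ≠ 1) : z.re < 1 := by
  refine lt_of_le_of_ne ((Complex.re_le_norm z).trans hz) fun h => h1 ?_
  have h2 := Complex.sq_norm z
  rw [Complex.normSq_apply, h] at h2
  have h3 : z.im = 0 := by
    have : ‖z‖ ^ 2 ≤ 1 := pow_le_one₀ (norm_nonneg z) hz
    nlinarith [sq_nonneg z.im]
  exact Complex.ext h h3

theorem half_le_norm_inv_one_sub {z : ℂ} (hz : ‖z‖ ≤ 1) (h1 : z ≠ 1) :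
    1 / 2 ≤ ‖(1 - z)⁻¹‖ := by
  have h0 : 0 < ‖1 - z‖ := norm_pos_iff.2 (sub_ne_zero.2 h1.symm)
  have h2 : ‖1 - z‖ ≤ 2 := (norm_sub_le _ _).trans (by rw [norm_one]; linarith)
  rw [norm_inv, one_div]
  exact inv_anti₀ h0 h2

theorem re_inv_one_sub_pos {z : ℂ} (hz : z.re < 1) : 0 < ((1 - z)⁻¹).re := by
  rw [Complex.inv_re]
  have : 0 < (1 - z).re := by simpa using hz
  refine div_pos this (Complex.normSq_pos.2 fun h => ?_)
  rw [h] at this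
  simp at this

theorem differentiableOn_comp_inv_one_sub {E : ℂ → ℂ} (hE : DifferentiableOn ℂ E {w | 0 < w.re}) :
    DifferentiableOn ℂ (fun z => E (1 - z)⁻¹) {z | z.re < 1} := by
  refine hE.comp (f := fun z => (1 - z)⁻¹) (fun z hz => ?_) fun z hz => re_inv_one_sub_pos hz
  refine DifferentiableAt.differentiableWithinAt (DifferentiableAt.inv (by fun_prop) ?_)
  intro h
  rw [← sub_eq_zero.1 h] at hz
  simp at hz

/-- The composite is holomorphic on `Re z < 1`, which contains the closed disc except the point `1`,
so boundary values come from plain continuity. -/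
theorem isBoundaryFunction_comp_inv_one_sub {E : ℂ → ℂ}
    (hE : DifferentiableOn ℂ E {w | 0 < w.re}) :
    IsBoundaryFunction (fun z : 𝔻 => E (1 - (z : ℂ))⁻¹)
      (fun θ => E (1 - (Circle.exp θ : ℂ))⁻¹) := by
  filter_upwards [ae_circleMeasure_mem_Ioo] with θ hθ a _
  have h1 : (Circle.exp θ : ℂ) ≠ 1 := fun h => by
    have := norm_one_sub_circleExp_pos hθ
    rw [h, sub_self, norm_zero] at this
    exact lt_irrefl _ this
  have hc : ContinuousAt (fun z => E (1 - z)⁻¹) (Circle.exp θ : ℂ) :=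
    ((differentiableOn_comp_inv_one_sub hE).continuousOn).continuousAt
      ((isOpen_lt Complex.continuous_re continuous_const).mem_nhds
        (re_lt_one_of_norm_le_one (Circle.norm_coe _).le h1))
  exact (hc.tendsto.comp tendsto_comap).mono_left inf_le_left

/-- Superlinear growth gives `t ≤ φ t` for large `t`. Thus a bound on `Φ(|f|)` inside the disc also
controls `log₊ |f|`, as Smirnov membership requires. -/
theorem StronglyConvex.exists_le_add {φ : ℝ → ℝ} (hφ : StronglyConvex φ) :
    ∃ K, 0 ≤ K ∧ ∀ s, 0 ≤ s → Real.posLog s ≤ K + compLog φ s := by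
  obtain ⟨T, hT⟩ := eventually_atTop.1 (hφ.tendsto.eventually_ge_atTop 1)
  refine ⟨max T 1, by positivity, fun s hs => ?_⟩
  rcases hs.eq_or_lt with rfl | hs
  · rw [Real.posLog_zero, compLog_zero]; positivity
  · rw [compLog_of_ne hs.ne']
    have h0 := hφ.nonneg (Real.log s)
    have h1 := le_max_left T 1
    have h2 := le_max_right T 1
    refine max_le (by positivity) ?_
    rcases le_total (max T 1) (Real.log s) with h | h
    · have := hT _ (h1.trans h)
      rw [le_div_iff₀ (by linarith)] at this
      linarith
    · linarith

/-- A function of `(1 - z)⁻¹` of slow growth belongs to the Hardy-Orlicz class. -/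
theorem mem_hardyOrlicz_of_le_sqrt {φ : ℝ → ℝ} (hφ : StronglyConvex φ) {E : ℂ → ℂ}
    (hE : DifferentiableOn ℂ E {w | 0 < w.re}) {C : ℝ} (hC : 0 ≤ C)
    (hb : ∀ w : ℂ, 0 < w.re → 1 / 2 ≤ ‖w‖ → compLog φ ‖E w‖ ≤ C * √‖w‖) :
    (fun z : 𝔻 => E (1 - (z : ℂ))⁻¹) ∈ hardyOrlicz φ := by
  have hhol : IsHolomorphic fun z : 𝔻 => E (1 - (z : ℂ))⁻¹ :=
    ⟨fun z => E (1 - z)⁻¹, (differentiableOn_comp_inv_one_sub hE).mono fun z hz =>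
      (Complex.re_le_norm z).trans_lt (mem_ball_zero_iff.1 hz), fun _ => rfl⟩
  have hbd := isBoundaryFunction_comp_inv_one_sub hE
  obtain ⟨K, hK, hle⟩ := hφ.exists_le_add
  have hb' : ∀ z : ℂ, ‖z‖ ≤ 1 → z ≠ 1 →
      compLog φ ‖E (1 - z)⁻¹‖ ≤ C * √(‖1 - z‖⁻¹) := fun z hz h1 => by
    rw [← norm_inv]
    exact hb _ (re_inv_one_sub_pos (re_lt_one_of_norm_le_one hz h1))
      (half_le_norm_inv_one_sub hz h1)
  have hne : ∀ {θ : ℝ}, θ ∈ Ioo 0 (2 * Real.pi) → (Circle.exp θ : ℂ) ≠ 1 := fun hθ h => by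
    have := norm_one_sub_circleExp_pos hθ
    rw [h, sub_self, norm_zero] at this
    exact lt_irrefl _ this
  have hlt : ∀ A B : ℝ, 0 ≤ A → 0 ≤ B → ∫⁻ θ, ENNReal.ofReal
      (A + B * √(‖1 - (Circle.exp θ : ℂ)‖⁻¹)) ∂circleMeasure < ∞ := by
    intro A B hA hB
    have : ∀ θ : ℝ, ENNReal.ofReal (A + B * √(‖1 - (Circle.exp θ : ℂ)‖⁻¹)) =
        ENNReal.ofReal A + ENNReal.ofReal B *
          ENNReal.ofReal √(‖1 - (Circle.exp θ : ℂ)‖⁻¹) := fun θ => by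
      rw [← ENNReal.ofReal_mul hB, ← ENNReal.ofReal_add hA (by positivity)]
    simp_rw [this]
    rw [lintegral_add_left' aemeasurable_const, lintegral_const, measure_univ, mul_one,
      lintegral_const_mul' _ _ ENNReal.ofReal_ne_top]
    exact ENNReal.add_lt_top.2 ⟨ENNReal.ofReal_lt_top,
      ENNReal.mul_lt_top ENNReal.ofReal_lt_top lintegral_sqrt_inv_norm_lt_top⟩
  refine ⟨?_, _, hbd, hbd.aemeasurable hhol, ?_⟩
  · refine mem_smirnovClass_of_dominated hhol hbd
      (G := fun _ θ => ENNReal.ofReal (K + 2 * C * √(‖1 - (Circle.exp θ : ℂ)‖⁻¹)))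
      (fun _ => ?_) (fun n => ?_) (Eventually.of_forall fun _ => tendsto_const_nhds)
      tendsto_const_nhds (hlt _ _ hK (by positivity)).ne
    · have : Measurable fun θ : ℝ => (Circle.exp θ : ℂ) :=
        (continuous_subtype_val.comp Circle.exp.continuous).measurable
      fun_prop
    · filter_upwards [ae_circleMeasure_mem_Ioo] with θ hθ
      refine ENNReal.ofReal_le_ofReal ((hle _ (norm_nonneg _)).trans ?_)
      have hr := (radius n).2
      set z : ℂ := ((radialPoint (radius n) (Circle.exp θ) : 𝔻) : ℂ)
      have hz : ‖z‖ = radius n := norm_radialPoint _ _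
      have hz1 : z ≠ 1 := fun h => by
        rw [h, norm_one] at hz
        linarith [hr.2]
      have h1 := hb' z (hz.le.trans hr.2.le) hz1
      -- On a radius, the distance to the circle is at most the distance to `1`. This yields one
      -- integrable majorant independent of the radius.
      have h2 : ‖1 - (Circle.exp θ : ℂ)‖ ≤ 2 * ‖1 - z‖ := by
        have e1 : ‖z - (Circle.exp θ : ℂ)‖ = 1 - radius n := by
          have : z - (Circle.exp θ : ℂ) = ((radius n - 1 : ℝ) : ℂ) * (Circle.exp θ : ℂ) := by
            simp only [z, coe_radialPoint]; push_cast; ring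
          rw [this, norm_mul, Circle.norm_coe, mul_one, Complex.norm_real, Real.norm_eq_abs,
            abs_sub_comm, abs_of_pos (sub_pos.2 hr.2)]
        have e2 : 1 - (radius n : ℝ) ≤ ‖1 - z‖ := by
          have := norm_sub_norm_le 1 z
          rwa [norm_one, hz] at this
        have e3 := norm_add_le (1 - z) (z - (Circle.exp θ : ℂ))
        rw [sub_add_sub_cancel] at e3
        linarith
      have h3 : √(‖1 - z‖⁻¹) ≤ 2 * √(‖1 - (Circle.exp θ : ℂ)‖⁻¹) := by
        have hpos := norm_one_sub_circleExp_pos hθ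
        have : ‖1 - z‖⁻¹ ≤ 2 ^ 2 * ‖1 - (Circle.exp θ : ℂ)‖⁻¹ := by
          have := inv_anti₀ (by linarith) (show ‖1 - (Circle.exp θ : ℂ)‖ / 2 ≤ ‖1 - z‖ by linarith)
          rw [inv_div, div_eq_mul_inv] at this
          have : 0 < ‖1 - (Circle.exp θ : ℂ)‖⁻¹ := inv_pos.2 hpos
          linarith
        calc √(‖1 - z‖⁻¹) ≤ √(2 ^ 2 * ‖1 - (Circle.exp θ : ℂ)‖⁻¹) := Real.sqrt_le_sqrt this
          _ = _ := by rw [Real.sqrt_mul (by norm_num), Real.sqrt_sq zero_le_two]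
      have h4 := mul_le_mul_of_nonneg_left h3 hC
      linarith
  · refine lt_of_le_of_lt (lintegral_mono_ae ?_) (hlt 0 C le_rfl hC)
    filter_upwards [ae_circleMeasure_mem_Ioo] with θ hθ
    rw [zero_add]
    exact ENNReal.ofReal_le_ofReal (hb' _ (Circle.norm_coe _).le (hne hθ))

/-! ### Slowly growing series and products in the right half-plane. -/

/-- Rapidly decreasing coefficients adapted to given thresholds. -/
theorem exists_rapidly_decreasing (Q : ℕ → ℝ) :
    ∃ ε : ℕ → ℝ, (∀ n, 0 < ε n) ∧ (∀ n, ε n ≤ 1) ∧ Summable ε ∧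
      ∀ x : ℝ, 0 ≤ x → ∃ n, (∀ m, n = m + 1 → Q m ≤ x) ∧ ∑' j, ε (j + n) * x ≤ 2 := by
  -- `R` is an increasing, unbounded majorant of `Q`; the coefficients will be `2 ^ (-n) / R n`.
  let R : ℕ → ℝ := fun n => n + 1 + ∑ j ∈ Finset.range (n + 1), |Q j|
  have hRmono : Monotone R := by
    refine monotone_nat_of_le_succ fun n => ?_
    simp only [R]
    rw [Finset.sum_range_succ _ (n + 1)]
    push_cast
    linarith [abs_nonneg (Q (n + 1))]
  have hR1 : ∀ n : ℕ, (n : ℝ) + 1 ≤ R n := fun n =>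
    le_add_of_nonneg_right (Finset.sum_nonneg fun _ _ => abs_nonneg _)
  have hR0 : ∀ n, 1 ≤ R n := fun n => le_trans (by simp) (hR1 n)
  have hRQ : ∀ n, Q n ≤ R n := fun n => by
    have h1 : |Q n| ≤ ∑ j ∈ Finset.range (n + 1), |Q j| :=
      Finset.single_le_sum (f := fun j => |Q j|) (fun _ _ => abs_nonneg _)
        (Finset.self_mem_range_succ n)
    have h2 := le_abs_self (Q n)
    have h3 : (0 : ℝ) ≤ n := n.cast_nonneg
    simp only [R]
    linarith
  have hpos : ∀ n, 0 < (1 / 2 : ℝ) ^ n / R n := fun n =>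
    div_pos (by positivity) (one_pos.trans_le (hR0 n))
  have hle : ∀ n, (1 / 2 : ℝ) ^ n / R n ≤ (1 / 2) ^ n := fun n =>
    div_le_self (by positivity) (hR0 n)
  have hsum : Summable fun n => (1 / 2 : ℝ) ^ n / R n :=
    summable_geometric_two.of_nonneg_of_le (fun n => (hpos n).le) hle
  refine ⟨fun n => (1 / 2) ^ n / R n, hpos,
    fun n => (hle n).trans (pow_le_one₀ (by norm_num) (by norm_num)), hsum, fun x hx => ?_⟩
  have hex : ∃ n, x < R n := by
    obtain ⟨n, hn⟩ := exists_nat_gt x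
    exact ⟨n, by linarith [hR1 n]⟩
  -- Take the first `n` with `x < R n`: minimality gives the threshold at `n - 1`, and from `n` on
  -- the terms are dominated by a geometric series of sum `2`.
  refine ⟨Nat.find hex, fun m hm => ?_, ?_⟩
  · exact (hRQ m).trans (not_lt.1 (Nat.find_min hex (by omega)))
  · have hn := Nat.find_spec hex
    set n := Nat.find hex
    refine (Summable.tsum_le_tsum (fun j => ?_) (((summable_nat_add_iff n).2 hsum).mul_right x)
      summable_geometric_two).trans tsum_geometric_two.le
    have hj : x ≤ R (j + n) := hn.le.trans (hRmono (by omega))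
    have hRp := one_pos.trans_le (hR0 (j + n))
    calc (1 / 2 : ℝ) ^ (j + n) / R (j + n) * x
        ≤ (1 / 2 : ℝ) ^ (j + n) / R (j + n) * R (j + n) :=
          mul_le_mul_of_nonneg_left hj (hpos _).le
      _ = (1 / 2 : ℝ) ^ (j + n) := div_mul_cancel₀ _ hRp.ne'
      _ ≤ (1 / 2) ^ j := pow_le_pow_of_le_one (by norm_num) (by norm_num) (by omega)

/-- The bound `ε n * |w|` is uniform only on bounded sets, so the Weierstrass test is applied in a
ball around each point. -/
theorem differentiableOn_tsum_of_norm_le {ε : ℕ → ℝ} (hε : ∀ n, 0 < ε n) (hs : Summable ε)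
    {h : ℕ → ℂ → ℂ} (hd : ∀ n, DifferentiableOn ℂ (h n) {w | 0 < w.re})
    (hb : ∀ n w, 0 < w.re → ‖h n w‖ ≤ ε n * ‖w‖) :
    DifferentiableOn ℂ (fun w => ∑' n, h n w) {w | 0 < w.re} := by
  intro w hw
  have hU : IsOpen ({w : ℂ | 0 < w.re} ∩ Metric.ball 0 (‖w‖ + 1)) :=
    (isOpen_lt continuous_const Complex.continuous_re).inter Metric.isOpen_ball
  have hwU : w ∈ {w : ℂ | 0 < w.re} ∩ Metric.ball 0 (‖w‖ + 1) :=
    ⟨hw, mem_ball_zero_iff.2 (lt_add_one _)⟩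
  have := Complex.differentiableOn_tsum_of_summable_norm (hs.mul_right (‖w‖ + 1))
    (fun n => (hd n).mono inter_subset_left) hU fun n v hv =>
      (hb n v hv.1).trans (mul_le_mul_of_nonneg_left (mem_ball_zero_iff.1 hv.2).le (hε n).le)
  exact (this.differentiableAt (hU.mem_nhds hwU)).differentiableWithinAt

theorem summable_of_norm_le {ε : ℕ → ℝ} (hs : Summable ε) {h : ℕ → ℂ} {x : ℝ}
    (hb : ∀ n, ‖h n‖ ≤ ε n * x) : Summable h :=
  Summable.of_norm_bounded (hs.mul_right x) hb

theorem one_le_re_one_add {ε : ℝ} {w : ℂ} (hε : 0 < ε) (hw : 0 < w.re) : 1 ≤ (1 + ε * w).re := by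
  simp only [Complex.add_re, Complex.one_re, Complex.re_ofReal_mul]
  linarith [mul_pos hε hw]

theorem one_le_norm_one_add {ε : ℝ} {w : ℂ} (hε : 0 < ε) (hw : 0 < w.re) :
    1 ≤ ‖1 + ε * w‖ :=
  (one_le_re_one_add hε hw).trans (Complex.re_le_norm _)

theorem mul_norm_le_norm_one_add {ε : ℝ} {w : ℂ} (hε : 0 < ε) (hw : 0 < w.re) :
    ε * ‖w‖ ≤ ‖1 + ε * w‖ := by
  have h0 : 0 < (ε * w).re := by rw [Complex.re_ofReal_mul]; exact mul_pos hε hw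
  have : ‖(ε : ℂ) * w‖ ≤ ‖1 + ε * w‖ := by
    rw [Complex.norm_def, Complex.norm_def]
    refine Real.sqrt_le_sqrt ?_
    rw [Complex.normSq_apply, Complex.normSq_apply, Complex.add_re, Complex.add_im,
      Complex.one_re, Complex.one_im]
    nlinarith
  rwa [norm_mul, Complex.norm_real, Real.norm_of_nonneg hε.le] at this

/-- The derivative of `log` has modulus at most `1` on the convex set `Re v ≥ 1`, which contains
both `1` and `1 + ε * w`. -/
theorem norm_log_one_add_le {ε : ℝ} {w : ℂ} (hε : 0 < ε) (hw : 0 < w.re) :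
    ‖Complex.log (1 + ε * w)‖ ≤ ε * ‖w‖ := by
  have hconv : Convex ℝ {v : ℂ | 1 ≤ v.re} := convex_halfSpace_re_ge 1
  have hd : ∀ v ∈ {v : ℂ | 1 ≤ v.re}, HasDerivWithinAt Complex.log v⁻¹ {v : ℂ | 1 ≤ v.re} v :=
    fun v hv => (Complex.hasDerivAt_log (Or.inl (one_pos.trans_le hv))).hasDerivWithinAt
  have := hconv.norm_image_sub_le_of_norm_hasDerivWithin_le (C := 1) hd (fun v hv => by
    rw [norm_inv]
    exact inv_le_one_of_one_le₀ (le_trans hv (Complex.re_le_norm v)))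
    (x := 1) (y := 1 + ε * w) (by simp) (one_le_re_one_add hε hw)
  rwa [Complex.log_one, sub_zero, one_mul, add_sub_cancel_left, norm_mul, Complex.norm_real,
    Real.norm_of_nonneg hε.le] at this

theorem sqrt_norm_ge {w : ℂ} (hw : 1 / 2 ≤ ‖w‖) : 1 / 2 ≤ √‖w‖ :=
  Real.le_sqrt_of_sq_le (by norm_num at hw ⊢; linarith)

theorem StronglyConvex.compLog_le_of_le {φ : ℝ → ℝ} (hφ : StronglyConvex φ) {s t : ℝ}
    (hs : 0 ≤ s) (h : s ≠ 0 → Real.log s ≤ t) : compLog φ s ≤ φ t := by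
  rcases hs.eq_or_lt with rfl | h0
  · rw [compLog_zero]; exact hφ.nonneg _
  · rw [compLog_of_ne h0.ne']
    exact hφ.monotone (h h0.ne')

/-- Every Hardy-Orlicz class contains an unbounded function. -/
theorem StronglyConvex.exists_unbounded {ψ : ℝ → ℝ} (hψ : StronglyConvex ψ) :
    ∃ g ∈ hardyOrlicz ψ, ¬ ∃ C : ℝ, ∀ z : 𝔻, ‖g z‖ ≤ C := by
  obtain ⟨ε, hε, -, hs, hQ⟩ :=
    -- With `n = m + 1` the sum is at most `n + 2 = m + 3`: its first `n` terms have modulus at most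
    -- `1` and its tail is at most `2`. The threshold makes `ψ` of the logarithm at most `√|w|`.
    exists_rapidly_decreasing fun m => ψ (Real.log ((m : ℝ) + 3)) ^ 2
  let h : ℕ → ℂ → ℂ := fun n w => ε n * w / (1 + ε n * w)
  have hne : ∀ n w, 0 < w.re → 1 + (ε n : ℂ) * w ≠ 0 := fun n w hw =>
    norm_pos_iff.1 (one_pos.trans_le (one_le_norm_one_add (hε n) hw))
  have hnorm : ∀ n w, ‖h n w‖ = ε n * ‖w‖ / ‖1 + ε n * w‖ := fun n w => by
    simp only [h]
    rw [norm_div, norm_mul, Complex.norm_real, Real.norm_of_nonneg (hε n).le]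
  have hb : ∀ n w, 0 < w.re → ‖h n w‖ ≤ ε n * ‖w‖ := fun n w hw => by
    rw [hnorm]
    exact div_le_self (mul_nonneg (hε n).le (norm_nonneg w)) (one_le_norm_one_add (hε n) hw)
  have hb1 : ∀ n w, 0 < w.re → ‖h n w‖ ≤ 1 := fun n w hw => by
    rw [hnorm]
    exact div_le_one_of_le₀ (mul_norm_le_norm_one_add (hε n) hw) (norm_nonneg _)
  have hd : ∀ n, DifferentiableOn ℂ (h n) {w | 0 < w.re} := fun n w hw =>
    (DifferentiableAt.fun_div (c := fun w => (ε n : ℂ) * w) (d := fun w => 1 + (ε n : ℂ) * w)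
      (by fun_prop) (by fun_prop) (hne n w hw)).differentiableWithinAt
  have hsum : ∀ w : ℂ, 0 < w.re → Summable fun n => h n w := fun w hw =>
    summable_of_norm_le hs fun n => hb n w hw
  have hp2 := hψ.nonneg (Real.log 2)
  refine ⟨_, mem_hardyOrlicz_of_le_sqrt hψ (differentiableOn_tsum_of_norm_le hε hs hd hb)
    (C := 1 + 2 * ψ (Real.log 2)) (by positivity) fun w hw hw2 => ?_, ?_⟩
  · obtain ⟨n, hn, htail⟩ := hQ ‖w‖ (norm_nonneg w)
    have hsn : Summable fun j => ‖h j w‖ :=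
      (hs.mul_right ‖w‖).of_nonneg_of_le (fun _ => norm_nonneg _) fun n => hb n w hw
    have hle : ‖∑' j, h j w‖ ≤ n + 2 := by
      refine (norm_tsum_le_tsum_norm hsn).trans ?_
      rw [← hsn.sum_add_tsum_nat_add n]
      refine add_le_add ?_ (le_trans ?_ htail)
      · refine (Finset.sum_le_card_nsmul _ _ 1 fun j _ => hb1 j w hw).trans ?_
        simp
      · exact ((summable_nat_add_iff n).2 hsn).tsum_le_tsum (fun j => hb _ w hw)
          ((summable_nat_add_iff n).2 (hs.mul_right ‖w‖))
    have h1 : compLog ψ ‖∑' j, h j w‖ ≤ ψ (Real.log (n + 2)) :=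
      hψ.compLog_le_of_le (norm_nonneg _) fun h0 =>
        Real.log_le_log ((norm_nonneg _).lt_of_ne' h0) hle
    have hsq := sqrt_norm_ge hw2
    refine h1.trans ?_
    -- For `n = 0` no threshold is available; the constant `ψ (log 2)` is absorbed using `√|w| ≥ 1 /
    -- 2`.
    rcases n with _ | m
    · rw [Nat.cast_zero, zero_add]
      nlinarith
    · have := Real.le_sqrt_of_sq_le (hn m rfl)
      rw [show ((m + 1 : ℕ) : ℝ) + 2 = m + 3 by push_cast; ring]
      nlinarith
  · rintro ⟨C, hC⟩
    obtain ⟨N, hN⟩ := exists_nat_gt (2 * C)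
    -- This forces `ε n * x ≥ 1` for all `n < N`, so each of these terms is at least `1 / 2` at `w =
    -- x`, that is at `z = 1 - 1 / x`.
    set x : ℝ := 1 + ∑ n ∈ Finset.range N, (ε n)⁻¹ with hx
    have hx1 : 1 ≤ x :=
      le_add_of_nonneg_right (Finset.sum_nonneg fun n _ => (inv_pos.2 (hε n)).le)
    have hx0 : 0 < x := by linarith
    have hinv : x⁻¹ ≤ 1 := inv_le_one_of_one_le₀ hx1
    have hz : ‖((1 - x⁻¹ : ℝ) : ℂ)‖ < 1 := by
      rw [Complex.norm_real, Real.norm_of_nonneg (by linarith)]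
      linarith [inv_pos.2 hx0]
    have h1 := hC (Complex.UnitDisc.mk _ hz)
    simp only [Complex.UnitDisc.coe_mk] at h1
    have hxw : (1 - ((1 - x⁻¹ : ℝ) : ℂ))⁻¹ = (x : ℂ) := by push_cast; simp
    rw [hxw] at h1
    have hxre : 0 < (x : ℂ).re := by simpa using hx0
    have hreal : ∀ n, (h n x).re = ε n * x / (1 + ε n * x) := fun n => by
      have : h n x = ((ε n * x / (1 + ε n * x) : ℝ) : ℂ) := by simp only [h]; push_cast; rfl
      rw [this, Complex.ofReal_re]
    have hsre : Summable fun n => (h n x).re := (Complex.reCLM.summable (hsum x hxre))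
    have h2 : ∑ n ∈ Finset.range N, (1 / 2 : ℝ) ≤ ∑' n, (h n x).re := by
      refine le_trans (Finset.sum_le_sum fun n hn => ?_) (hsre.sum_le_tsum _ fun n _ => ?_)
      · have hle : (ε n)⁻¹ ≤ x := by
          have := Finset.single_le_sum (f := fun n => (ε n)⁻¹)
            (fun n _ => (inv_pos.2 (hε n)).le) hn
          linarith
        have h3 : 1 ≤ ε n * x := by
          have := mul_le_mul_of_nonneg_left hle (hε n).le
          rwa [mul_inv_cancel₀ (hε n).ne'] at this
        rw [hreal, div_le_div_iff₀ two_pos (by linarith)]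
        linarith
      · rw [hreal]
        have := mul_pos (hε n) hx0
        positivity
    rw [← Complex.re_tsum (hsum x hxre)] at h2
    have h4 := Complex.re_le_norm (∑' n, h n x)
    rw [Finset.sum_const, Finset.card_range, nsmul_eq_mul] at h2
    linarith

/-- If `φ` grows more slowly than every exponential, `H_Φ` contains a function which is in no Hardy
space. -/
theorem StronglyConvex.exists_notMem_hardySpace {φ : ℝ → ℝ} (hφ : StronglyConvex φ)
    (hexp : ∀ p : ℝ, 0 < p → ∀ᶠ t in atTop, φ t ≤ Real.exp (p * t)) :
    ∃ f ∈ hardyOrlicz φ, ∀ p : ℝ, 0 < p → f ∉ hardySpace p := by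
  have hthr : ∀ m : ℕ, ∃ Q : ℝ, ∀ x, Q ≤ x →
      φ ((m + 1) * Real.log (1 + x) + 2) ≤ √x := by
    intro m
    have hlog : Tendsto (fun x : ℝ => Real.log (1 + x)) atTop atTop :=
      Real.tendsto_log_atTop.comp (tendsto_atTop_add_const_left _ _ tendsto_id)
    have hm : (0 : ℝ) < m + 3 := by positivity
    have h1 : Tendsto (fun x : ℝ => (m + 3) * Real.log (1 + x)) atTop atTop :=
      hlog.const_mul_atTop hm
    -- With this exponent the exponential bound at `(m + 3) * log (1 + x)` is `(1 + x) ^ (1 / 4)`,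
    -- which is at most `√x` because `1 + x ≤ x ^ 2`.
    have hp : 0 < 1 / (4 * ((m : ℝ) + 3)) := by positivity
    refine eventually_atTop.1 ?_
    filter_upwards [h1.eventually (hexp _ hp), hlog.eventually_ge_atTop 1,
      eventually_ge_atTop 2] with x hx hl h2
    calc φ ((m + 1) * Real.log (1 + x) + 2) ≤ φ ((m + 3) * Real.log (1 + x)) :=
          hφ.monotone (by linarith)
      _ ≤ _ := hx
      _ = Real.exp (Real.log (1 + x) / 4) := by congr 1; field_simp
      _ ≤ Real.exp (Real.log x * (1 / 2)) := by
          refine Real.exp_le_exp.2 ?_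
          have : Real.log (1 + x) ≤ Real.log (x ^ 2) :=
            Real.log_le_log (by linarith) (by nlinarith)
          rw [Real.log_pow] at this
          push_cast at this
          linarith
      _ = √x := by
          rw [Real.sqrt_eq_rpow, Real.rpow_def_of_pos (by linarith)]
  choose Q hQ' using hthr
  obtain ⟨ε, hε, hε1, hs, hQ⟩ := exists_rapidly_decreasing Q
  let h : ℕ → ℂ → ℂ := fun n w => Complex.log (1 + ε n * w)
  have hb : ∀ n w, 0 < w.re → ‖h n w‖ ≤ ε n * ‖w‖ := fun n w hw => norm_log_one_add_le (hε n) hw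
  have hd : ∀ n, DifferentiableOn ℂ (h n) {w | 0 < w.re} := fun n w hw =>
    (DifferentiableAt.clog (f := fun w => 1 + (ε n : ℂ) * w) (x := w) (by fun_prop)
      (Or.inl (one_pos.trans_le (one_le_re_one_add (hε n) hw)))).differentiableWithinAt
  have hsum : ∀ w : ℂ, 0 < w.re → Summable fun n => h n w := fun w hw =>
    summable_of_norm_le hs fun n => hb n w hw
  -- This is the infinite product of the factors `1 + ε n * w`, zero-free by construction.
  let E : ℂ → ℂ := fun w => Complex.exp (∑' n, h n w)
  have hE : DifferentiableOn ℂ E {w | 0 < w.re} :=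
    (differentiableOn_tsum_of_norm_le hε hs hd hb).cexp
  have hre : ∀ n w, (h n w).re = Real.log ‖1 + ε n * w‖ := fun n w => Complex.log_re _
  have hsre : ∀ w : ℂ, 0 < w.re → Summable fun n => Real.log ‖1 + ε n * w‖ := fun w hw =>
    (Complex.reCLM.summable (hsum w hw)).congr fun n => hre n w
  have hlogE : ∀ w : ℂ, 0 < w.re → Real.log ‖E w‖ = ∑' n, Real.log ‖1 + ε n * w‖ := by
    intro w hw
    simp only [E]
    rw [Complex.norm_exp, Real.log_exp, Complex.re_tsum (hsum w hw)]
    exact tsum_congr fun n => hre n w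
  have hE0 : ∀ w, ‖E w‖ ≠ 0 := fun w => norm_ne_zero_iff.2 (Complex.exp_ne_zero _)
  have hp2 := hφ.nonneg 2
  refine ⟨_, mem_hardyOrlicz_of_le_sqrt hφ hE (C := 1 + 2 * φ 2) (by positivity)
    fun w hw hw2 => ?_, fun p hp hmem => ?_⟩
  · obtain ⟨n, hn, htail⟩ := hQ ‖w‖ (norm_nonneg w)
    have hle : Real.log ‖E w‖ ≤ n * Real.log (1 + ‖w‖) + 2 := by
      rw [hlogE w hw, ← (hsre w hw).sum_add_tsum_nat_add n]
      refine add_le_add ?_ (le_trans ?_ htail)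
      · refine (Finset.sum_le_card_nsmul _ _ (Real.log (1 + ‖w‖)) fun j _ => ?_).trans ?_
        · refine Real.log_le_log (one_pos.trans_le (one_le_norm_one_add (hε j) hw)) ?_
          refine (norm_add_le _ _).trans ?_
          rw [norm_one, norm_mul, Complex.norm_real, Real.norm_of_nonneg (hε j).le]
          have := mul_le_of_le_one_left (norm_nonneg w) (hε1 j)
          linarith
        · simp
      · refine ((summable_nat_add_iff n).2 (hsre w hw)).tsum_le_tsum (fun j => ?_)
          ((summable_nat_add_iff n).2 (hs.mul_right ‖w‖))
        rw [← hre]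
        exact (Complex.re_le_norm _).trans (hb _ w hw)
    rw [compLog_of_ne (hE0 w)]
    refine (hφ.monotone hle).trans ?_
    have hsq := sqrt_norm_ge hw2
    rcases n with _ | m
    · rw [Nat.cast_zero, zero_mul, zero_add]
      nlinarith
    · have := hQ' m _ (hn m rfl)
      push_cast
      nlinarith
  · obtain ⟨-, u, hu, -, hfin⟩ := hmem
    have hae := hu.ae_eq (isBoundaryFunction_comp_inv_one_sub hE)
    -- Already `N ≥ 1 / p` factors give `|E|` at least a constant times `|w| ^ N`, so `|E| ^ p` is
    -- at least a constant times `|w|`. On the circle this exceeds a multiple of `1 / θ` near `0`,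
    -- which is not integrable.
    obtain ⟨N, hN⟩ := exists_nat_ge (1 / p)
    have hNp : 1 ≤ p * N := by rwa [div_le_iff₀' hp] at hN
    set c : ℝ := ∑ n ∈ Finset.range N, Real.log (ε n)
    have hlow : ∀ w : ℂ, 0 < w.re → 1 ≤ ‖w‖ →
        Real.exp (p * c) * ‖w‖ ≤ compLog (fun t => Real.exp (p * t)) ‖E w‖ := by
      intro w hw hw1
      rw [compLog_of_ne (hE0 w)]
      have hw0 : 0 < ‖w‖ := by linarith
      have h1 : c + N * Real.log ‖w‖ ≤ Real.log ‖E w‖ := by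
        rw [hlogE w hw]
        refine le_trans ?_ ((hsre w hw).sum_le_tsum (Finset.range N) fun n _ =>
          Real.log_nonneg (one_le_norm_one_add (hε n) hw))
        rw [show (N : ℝ) * Real.log ‖w‖ = ∑ n ∈ Finset.range N, Real.log ‖w‖ by simp,
          ← Finset.sum_add_distrib]
        refine Finset.sum_le_sum fun n _ => ?_
        rw [← Real.log_mul (hε n).ne' hw0.ne']
        exact Real.log_le_log (mul_pos (hε n) hw0) (mul_norm_le_norm_one_add (hε n) hw)
      have h2 : Real.log ‖w‖ ≤ p * N * Real.log ‖w‖ :=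
        le_mul_of_one_le_left (Real.log_nonneg hw1) hNp
      calc Real.exp (p * c) * ‖w‖ = Real.exp (p * c + Real.log ‖w‖) := by
            rw [Real.exp_add, Real.exp_log hw0]
        _ ≤ _ := Real.exp_le_exp.2 (by
            have := mul_le_mul_of_nonneg_left h1 hp.le
            linarith)
    have hpi : 1 ≤ 2 * Real.pi := by linarith [Real.pi_gt_three]
    have hle : ∫⁻ θ, ENNReal.ofReal (if θ ≤ 1 then Real.exp (p * c) * θ⁻¹ else 0)
        ∂circleMeasure ≤
        ∫⁻ θ, ENNReal.ofReal (compLog (fun t => Real.exp (p * t)) ‖u θ‖) ∂circleMeasure := by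
      refine lintegral_mono_ae ?_
      filter_upwards [hae, ae_circleMeasure_mem_Ioo] with θ h1 hθ
      split_ifs with hθ1
      swap
      · rw [ENNReal.ofReal_zero]; exact zero_le
      refine ENNReal.ofReal_le_ofReal ?_
      rw [h1]
      have hpos := norm_one_sub_circleExp_pos hθ
      have hle : ‖1 - (Circle.exp θ : ℂ)‖ ≤ θ := by
        rw [norm_one_sub_circleExp ⟨hθ.1.le, hθ.2.le⟩]
        have := Real.sin_le (show 0 ≤ θ / 2 by linarith [hθ.1])
        linarith
      have hinv : θ⁻¹ ≤ ‖(1 - (Circle.exp θ : ℂ))⁻¹‖ := by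
        rw [norm_inv]; exact inv_anti₀ hpos hle
      have hne : (Circle.exp θ : ℂ) ≠ 1 := fun h => by
        rw [h, sub_self, norm_zero] at hpos
        exact lt_irrefl _ hpos
      refine le_trans (mul_le_mul_of_nonneg_left hinv (Real.exp_pos _).le) (hlow _
        (re_inv_one_sub_pos (re_lt_one_of_norm_le_one (Circle.norm_coe _).le hne)) ?_)
      exact ((one_le_inv₀ hθ.1).2 hθ1).trans hinv
    have hlt := hle.trans_lt hfin
    rw [circleMeasure, lintegral_smul_measure, smul_eq_mul] at hlt
    have hk : ENNReal.ofReal (1 / (2 * Real.pi)) ≠ 0 := by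
      rw [Ne, ENNReal.ofReal_eq_zero, not_le]; positivity
    have hlt2 := ENNReal.lt_top_of_mul_ne_top_right hlt.ne hk
    have hlt3 : ∫⁻ θ in Ioc (0 : ℝ) 1, ENNReal.ofReal (Real.exp (p * c) * θ⁻¹) < ∞ := by
      refine lt_of_le_of_lt ?_ hlt2
      refine le_trans (le_of_eq ?_) (lintegral_mono_set (Ioc_subset_Ioc_right hpi))
      refine setLIntegral_congr_fun measurableSet_Ioc fun θ hθ => ?_
      simp only [if_pos hθ.2]
    have hint : IntegrableOn (fun θ : ℝ => Real.exp (p * c) * θ⁻¹) (Ioc 0 1) := by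
      refine ⟨(measurable_const.mul measurable_inv).aestronglyMeasurable, ?_⟩
      rw [hasFiniteIntegral_iff_ofReal]
      · exact hlt3
      · filter_upwards [ae_restrict_mem measurableSet_Ioc] with θ hθ
        exact mul_nonneg (Real.exp_pos _).le (inv_nonneg.2 hθ.1.le)
    have hint2 : IntervalIntegrable (fun θ : ℝ => θ⁻¹) volume 0 1 := by
      rw [intervalIntegrable_iff_integrableOn_Ioc_of_le zero_le_one]
      refine (hint.const_mul (Real.exp (p * c))⁻¹).congr (Eventually.of_forall fun θ => ?_)
      simp only []
      rw [← mul_assoc, inv_mul_cancel₀ (Real.exp_pos _).ne', one_mul]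
    rw [intervalIntegrable_inv_iff] at hint2
    simp at hint2

/-! ### Iterated logarithms and the functions `exp (t / log_k t)`. -/

theorem iterLog_succ (k : ℕ) (t : ℝ) : iterLog (k + 1) t = Real.log (iterLog k t) :=
  Function.iterate_succ_apply' _ _ _

theorem tendsto_iterLog (k : ℕ) : Tendsto (iterLog k) atTop atTop := by
  induction k with
  | zero => exact tendsto_id
  | succ k ih => exact (Real.tendsto_log_atTop.comp ih).congr fun t => (iterLog_succ k t).symm

theorem eventually_iterLog_le_log {k : ℕ} (hk : 1 ≤ k) :
    ∀ᶠ t in atTop, iterLog k t ≤ Real.log t := by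
  induction k, hk using Nat.le_induction with
  | base => exact Eventually.of_forall fun t => le_rfl
  | succ k _ ih =>
    filter_upwards [ih, (tendsto_iterLog k).eventually_ge_atTop 0] with t h1 h2
    rw [iterLog_succ]
    exact (Real.log_le_self h2).trans h1

/-- The derivative of `log_k` is `q t / t` with a nonincreasing function `q` with values in
`(0, 1]`. -/
theorem exists_hasDerivAt_iterLog {k : ℕ} (hk : 1 ≤ k) :
    ∃ T : ℝ, ∃ q : ℝ → ℝ, 1 ≤ T ∧ AntitoneOn q (Ici T) ∧ MonotoneOn (iterLog k) (Ici T) ∧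
      ∀ t, T ≤ t → 0 < q t ∧ q t ≤ 1 ∧ HasDerivAt (iterLog k) (q t / t) t := by
  induction k, hk using Nat.le_induction with
  | base =>
    refine ⟨1, fun _ => 1, le_rfl, antitoneOn_const, fun s hs t _ hst => ?_, fun t ht =>
      ⟨one_pos, le_rfl, ?_⟩⟩
    · exact Real.log_le_log (one_pos.trans_le hs) hst
    · rw [one_div]
      exact Real.hasDerivAt_log (by linarith)
  | succ k _ ih =>
    obtain ⟨T, q, hT, hq, hm, h⟩ := ih
    obtain ⟨S, hS⟩ := eventually_atTop.1 ((tendsto_iterLog k).eventually_ge_atTop 1)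
    have hmT : ∀ {t}, max T S ≤ t → T ≤ t := fun ht => (le_max_left _ _).trans ht
    have hmS : ∀ {t}, max T S ≤ t → 1 ≤ iterLog k t := fun ht => hS _ ((le_max_right _ _).trans ht)
    refine ⟨max T S, fun t => q t / iterLog k t, hT.trans (le_max_left _ _),
      fun s hs t ht hst => ?_, fun s hs t ht hst => ?_, fun t ht => ?_⟩
    · exact div_le_div₀ (h s (hmT hs)).1.le (hq (hmT hs) (hmT ht) hst)
        (one_pos.trans_le (hmS hs)) (hm (hmT hs) (hmT ht) hst)
    · rw [iterLog_succ, iterLog_succ]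
      exact Real.log_le_log (one_pos.trans_le (hmS hs)) (hm (hmT hs) (hmT ht) hst)
    · obtain ⟨h1, h2, h3⟩ := h t (hmT ht)
      have h4 := hmS ht
      have h5 : 0 < iterLog k t := one_pos.trans_le h4
      refine ⟨div_pos h1 h5, div_le_one_of_le₀ (h2.trans h4) h5.le, ?_⟩
      have := h3.log h5.ne'
      rw [div_right_comm]
      exact this.congr_of_eventuallyEq (Eventually.of_forall fun s => iterLog_succ k s)

theorem hasDerivAt_ite_le {a b a' b' : ℝ → ℝ} {T : ℝ} (ha : ∀ t, t ≤ T → HasDerivAt a (a' t) t)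
    (hb : ∀ t, T ≤ t → HasDerivAt b (b' t) t) (h0 : a T = b T) (h1 : a' T = b' T) (t : ℝ) :
    HasDerivAt (fun t => if t ≤ T then a t else b t) (if t ≤ T then a' t else b' t) t := by
  rcases lt_trichotomy t T with h | rfl | h
  · rw [if_pos h.le]
    refine (ha t h.le).congr_of_eventuallyEq ?_
    filter_upwards [gt_mem_nhds h] with s hs using if_pos (le_of_lt hs)
  · rw [if_pos le_rfl]
    have l : HasDerivWithinAt (fun s => if s ≤ t then a s else b s) (a' t) (Iic t) t :=
      (ha t le_rfl).hasDerivWithinAt.congr (fun s hs => if_pos hs) (if_pos le_rfl)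
    have r : HasDerivWithinAt (fun s => if s ≤ t then a s else b s) (a' t) (Ici t) t := by
      rw [h1]
      refine (hb t le_rfl).hasDerivWithinAt.congr (fun s hs => ?_) ((if_pos le_rfl).trans h0)
      rcases (mem_Ici.1 hs).eq_or_lt with rfl | hs
      · exact (if_pos le_rfl).trans h0
      · exact if_neg (not_le.2 hs)
    rw [← hasDerivWithinAt_univ, ← Iic_union_Ici (a := t)]
    exact l.union r
  · rw [if_neg (not_le.2 h)]
    refine (hb t h.le).congr_of_eventuallyEq ?_
    filter_upwards [lt_mem_nhds h] with s hs using if_neg (not_le.2 hs)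

/-- Write `l = log_k`, `l' = q / t`. Beyond a threshold the derivative of `exp (t / l)` is `(l - q)
* exp (t / l - 2 * log l)`, a product of positive nondecreasing factors, which gives convexity. To
the left of the threshold the function is continued in a C¹ way. -/
theorem exists_isExpDivIterLog {k : ℕ} (hk : 1 ≤ k) : ∃ φ, IsExpDivIterLog k φ := by
  obtain ⟨T₀, q, hT₀, hq, hmono, hder⟩ := exists_hasDerivAt_iterLog hk
  obtain ⟨S, hS⟩ := eventually_atTop.1 ((tendsto_iterLog k).eventually_ge_atTop 2)
  set T : ℝ := max (max T₀ S) 4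
  have hTT₀ : ∀ {t}, T ≤ t → T₀ ≤ t := fun h =>
    ((le_max_left _ _).trans (le_max_left _ _)).trans h
  have hT4 : ∀ {t}, T ≤ t → 4 ≤ t := fun h => (le_max_right _ _).trans h
  have hl : ∀ {t}, T ≤ t → 2 ≤ iterLog k t := fun h =>
    hS _ (((le_max_right _ _).trans (le_max_left _ _)).trans h)
  set l := iterLog k
  have hLd : ∀ t, T ≤ t → HasDerivAt (fun t => t / l t) ((l t - q t) / l t ^ 2) t := by
    intro t ht
    have h0 : t ≠ 0 := by linarith [hT4 ht]
    have := (hasDerivAt_id t).fun_div (hder t (hTT₀ ht)).2.2 (by linarith [hl ht])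
    refine this.congr_deriv ?_
    simp only [id, one_mul, mul_div_cancel₀ _ h0]
  have hMmono : MonotoneOn (fun t => t / l t - 2 * Real.log (l t)) (Ici T) := by
    have hMd : ∀ t, T ≤ t → HasDerivAt (fun t => t / l t - 2 * Real.log (l t))
        ((l t - q t) / l t ^ 2 - 2 * (q t / t / l t)) t := fun t ht =>
      (hLd t ht).sub (((hder t (hTT₀ ht)).2.2.log (by linarith [hl ht])).const_mul 2)
    refine monotoneOn_of_deriv_nonneg (convex_Ici T)
      (fun t ht => (hMd t ht).continuousAt.continuousWithinAt)
      (fun t ht => ((hMd t (interior_subset ht)).differentiableAt).differentiableWithinAt)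
      fun t ht => ?_
    have ht := interior_subset ht
    rw [(hMd t ht).deriv]
    have h4 := hT4 ht
    have h2 := hl ht
    obtain ⟨hq0, hq1, -⟩ := hder t (hTT₀ ht)
    have hlp : 0 < l t := by linarith
    have htp : 0 < t := by linarith
    have : (l t - q t) / l t ^ 2 - 2 * (q t / t / l t) =
        ((l t - q t) * t - 2 * q t * l t) / (l t ^ 2 * t) := by
      field_simp
    rw [this]
    refine div_nonneg ?_ (by positivity)
    -- As `q ≤ 1`, it is enough that `(l - 1) * t ≥ 2 * l`; this holds for `l ≥ 2` and `t ≥ 4`, with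
    -- equality at the corner, whence the choice of `T`.
    nlinarith [mul_nonneg (sub_nonneg.2 h2) (sub_nonneg.2 h4),
      mul_nonneg (sub_nonneg.2 hq1) (by linarith : 0 ≤ t + 2 * l t)]
  set D : ℝ → ℝ := fun t => Real.exp (t / l t) * ((l t - q t) / l t ^ 2) with hD
  have hDd : ∀ t, T ≤ t → HasDerivAt (fun t => Real.exp (t / l t)) (D t) t := fun t ht =>
    (hLd t ht).exp
  have hDeq : ∀ t, T ≤ t → D t = (l t - q t) * Real.exp (t / l t - 2 * Real.log (l t)) := by
    intro t ht
    have hlp : 0 < l t := by linarith [hl ht]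
    rw [Real.exp_sub, mul_comm 2, Real.exp_mul, Real.exp_log hlp, hD]
    norm_cast
    ring
  have hDpos : ∀ t, T ≤ t → 0 < D t := fun t ht => by
    have := (hder t (hTT₀ ht)).2.1
    rw [hDeq t ht]
    exact mul_pos (by linarith [hl ht]) (Real.exp_pos _)
  have hDmono : ∀ s t, T ≤ s → s ≤ t → D s ≤ D t := by
    intro s t hs hst
    have ht := hs.trans hst
    rw [hDeq s hs, hDeq t ht]
    have h1 := hmono (hTT₀ hs) (hTT₀ ht) hst
    have h2 := hq (hTT₀ hs) (hTT₀ ht) hst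
    have h3 := (hder t (hTT₀ ht)).2.1
    exact mul_le_mul (by linarith) (Real.exp_le_exp.2 (hMmono hs ht hst)) (Real.exp_pos _).le
      (by linarith [hl ht])
  set B : ℝ := (l T - q T) / l T ^ 2 with hB
  have hDT : D T = Real.exp (T / l T) * B := rfl
  have hBpos : 0 < B := pos_of_mul_pos_right (hDT ▸ hDpos T le_rfl) (Real.exp_pos _).le
  -- An exponential matching value and slope at `T` stays positive, strictly increasing and convex
  -- on the whole left half-line; a tangent line would become negative.
  set a : ℝ → ℝ := fun t => Real.exp (T / l T + B * (t - T))
  have had : ∀ t, HasDerivAt a (a t * B) t := fun t => by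
    have h1 : HasDerivAt (fun t => T / l T + B * (t - T)) B t := by
      simpa using (((hasDerivAt_id t).sub_const T).const_mul B).const_add (T / l T)
    exact h1.exp
  have haT : a T = Real.exp (T / l T) := by simp [a]
  set φ : ℝ → ℝ := fun t => if t ≤ T then a t else Real.exp (t / l t)
  have hφd : ∀ t, HasDerivAt φ (if t ≤ T then a t * B else D t) t :=
    hasDerivAt_ite_le (fun t _ => had t) hDd haT (by rw [haT, hDT])
  have hderiv : deriv φ = fun t => if t ≤ T then a t * B else D t :=
    funext fun t => (hφd t).deriv
  have hpos : ∀ t, 0 < deriv φ t := fun t => by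
    rw [hderiv]
    simp only []
    split_ifs with h
    · exact mul_pos (Real.exp_pos _) hBpos
    · exact hDpos t (not_le.1 h).le
  have hamono : ∀ s t, s ≤ t → a s * B ≤ a t * B := fun s t hst =>
    mul_le_mul_of_nonneg_right (Real.exp_le_exp.2 (by
      have := mul_le_mul_of_nonneg_left hst hBpos.le
      linarith)) hBpos.le
  have hdm : Monotone (deriv φ) := by
    intro s t hst
    rw [hderiv]
    simp only []
    split_ifs with h1 h2 h2
    · exact hamono s t hst
    · refine (hamono s T h1).trans ?_
      rw [haT, ← hDT]
      exact hDmono T t le_rfl (not_le.1 h2).le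
    · exact absurd (hst.trans h2) h1
    · exact hDmono s t (not_le.1 h1).le hst
  have hsm : StrictMono φ := strictMono_of_deriv_pos hpos
  have hev : ∀ᶠ t in atTop, φ t = Real.exp (t / l t) := by
    filter_upwards [eventually_gt_atTop T] with t ht using if_neg (not_le.2 ht)
  refine ⟨φ, ⟨fun t => ?_, ?_, hsm.monotone, ?_⟩, hsm, hev⟩
  · simp only [φ]
    split_ifs <;> exact (Real.exp_pos _).le
  · exact hdm.convexOn_univ_of_deriv fun t => (hφd t).differentiableAt
  -- From `l t ≤ log t` and `(log t) ^ 2 ≤ t / 2` follows `t / l t ≥ 2 * log t`, so `φ t ≥ t ^ 2`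
  -- eventually.
  · have hsmall := (Asymptotics.isLittleO_iff.1 (Real.isLittleO_pow_log_id_atTop (n := 2)))
      (show (0 : ℝ) < 1 / 2 by norm_num)
    refine tendsto_atTop_mono' _ ?_ tendsto_id
    filter_upwards [hev, hsmall, eventually_iterLog_le_log hk, eventually_ge_atTop T] with
      t h1 h2 h3 h4
    have ht : 0 < t := by linarith [hT4 h4]
    have hlt : 2 ≤ l t := hl h4
    have h3' : l t ≤ Real.log t := h3
    rw [id, h1, le_div_iff₀ ht]
    rw [Real.norm_of_nonneg (by positivity), id, Real.norm_of_nonneg ht.le] at h2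
    have h5 : 2 * Real.log t ≤ t / l t := by
      rw [le_div_iff₀ (by linarith)]
      nlinarith
    calc t * t = Real.exp (2 * Real.log t) := by
          rw [two_mul, Real.exp_add, Real.exp_log ht]
      _ ≤ _ := Real.exp_le_exp.2 h5

theorem StronglyConvex.tendsto_atTop {φ : ℝ → ℝ} (hφ : StronglyConvex φ) :
    Tendsto φ atTop atTop := by
  refine (hφ.tendsto.atTop_mul_atTop₀ tendsto_id).congr' ?_
  filter_upwards [eventually_gt_atTop 0] with t ht
  exact div_mul_cancel₀ _ ht.ne'

/-- Between consecutive `t n` the quotient `t / log_k t` increases by exactly `log 2`. Replacing the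
denominator at `t (n + 1)` by the smaller one at `t n` bounds the gap below by `log 2 * log_k (t
n)`. -/
theorem IsExpDivIterLog.hasDyadicGaps {k : ℕ} (hk : 1 ≤ k) {φ : ℝ → ℝ}
    (h : IsExpDivIterLog k φ) : HasDyadicGaps φ := by
  obtain ⟨hφ, hm, hev⟩ := h
  have hcont : Continuous φ := continuousOn_univ.1 (hφ.convexOn.continuousOn isOpen_univ)
  have hpow : Tendsto (fun n : ℕ => (2 : ℝ) ^ n) atTop atTop :=
    tendsto_pow_atTop_atTop_of_one_lt one_lt_two
  have hex : ∀ n : ℕ, φ 0 ≤ 2 ^ n → ∃ t, φ t = 2 ^ n := fun n hn =>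
    mem_range_of_exists_le_of_exists_ge hcont ⟨0, hn⟩
      (hφ.tendsto_atTop.eventually_ge_atTop _).exists
  have hex' : ∀ n : ℕ, ∃ t, φ 0 ≤ 2 ^ n → φ t = 2 ^ n := fun n => by
    by_cases hn : φ 0 ≤ 2 ^ n
    · obtain ⟨t, ht⟩ := hex n hn
      exact ⟨t, fun _ => ht⟩
    · exact ⟨0, fun h => absurd h hn⟩
  choose t ht using hex'
  have ht' : ∀ᶠ n in atTop, φ (t n) = 2 ^ n := by
    filter_upwards [hpow.eventually_ge_atTop (φ 0)] with n hn using ht n hn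
  have htop : Tendsto t atTop atTop := by
    refine tendsto_atTop.2 fun M => ?_
    filter_upwards [ht', hpow.eventually_ge_atTop (φ M)] with n h1 h2
    rw [← h1] at h2
    exact hm.le_iff_le.1 h2
  refine ⟨t, ht', ?_⟩
  obtain ⟨T, -, hT, -, hmono, -⟩ := exists_hasDerivAt_iterLog hk
  refine tendsto_atTop_mono' _ ?_
    (((tendsto_iterLog k).comp htop).const_mul_atTop (Real.log_pos one_lt_two))
  have hev2 := htop.eventually (hev.and ((eventually_ge_atTop T).and
    ((tendsto_iterLog k).eventually_ge_atTop 1)))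
  have hshift := tendsto_add_atTop_nat 1
  filter_upwards [ht', hev2, hshift.eventually ht', hshift.eventually hev2] with n h1 h2 h3 h4
  obtain ⟨e1, b1, c1⟩ := h2
  obtain ⟨e2, b2, c2⟩ := h4
  simp only [Function.comp_apply]
  rw [h1] at e1
  rw [h3, pow_succ, e1] at e2
  have hlt : t n ≤ t (n + 1) := by
    rw [← hm.le_iff_le, h1, h3]
    exact pow_le_pow_right₀ one_le_two (Nat.le_succ n)
  have hl := hmono b1 b2 hlt
  have e3 := congrArg Real.log e2
  rw [Real.log_mul (Real.exp_pos _).ne' two_ne_zero, Real.log_exp, Real.log_exp] at e3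
  have hlp : 0 < iterLog k (t n) := by linarith
  have h5 : t (n + 1) / iterLog k (t (n + 1)) ≤ t (n + 1) / iterLog k (t n) :=
    div_le_div_of_nonneg_left (by linarith) hlp hl
  rw [← e3, div_add' _ _ _ hlp.ne', div_le_div_iff_of_pos_right hlp] at h5
  linarith

/-! ### Comparison with the Hardy spaces and conclusion. -/

theorem IsExpDivIterLog.eventually_le_exp {k : ℕ} {φ : ℝ → ℝ} (h : IsExpDivIterLog k φ)
    (p : ℝ) (hp : 0 < p) : ∀ᶠ t in atTop, φ t ≤ Real.exp (p * t) := by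
  filter_upwards [h.2.2, (tendsto_iterLog k).eventually_ge_atTop p⁻¹, eventually_ge_atTop 0] with
    t h1 h2 h3
  rw [h1]
  refine Real.exp_le_exp.2 ?_
  rw [div_le_iff₀ (lt_of_lt_of_le (inv_pos.2 hp) h2)]
  have := mul_le_mul_of_nonneg_left h2 (mul_nonneg hp.le h3)
  rw [mul_right_comm, mul_inv_cancel₀ hp.ne', one_mul] at this
  exact this

theorem StronglyConvex.hardySpace_subset {φ : ℝ → ℝ} (hφ : StronglyConvex φ) {p : ℝ}
    (h : ∀ᶠ t in atTop, φ t ≤ Real.exp (p * t)) : hardySpace p ⊆ hardyOrlicz φ := by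
  rintro f ⟨hf, u, hu, hum, hfin⟩
  refine ⟨hf, u, hu, hum, ?_⟩
  obtain ⟨T, hT⟩ := eventually_atTop.1 h
  have hle : ∀ s : ℝ, compLog φ s ≤ compLog (fun t => Real.exp (p * t)) s + φ T := fun s => by
    rcases eq_or_ne s 0 with rfl | hs
    · rw [compLog_zero, compLog_zero, zero_add]; exact hφ.nonneg T
    · rw [compLog_of_ne hs, compLog_of_ne hs]
      rcases le_total T (Real.log s) with h1 | h1
      · linarith [hT _ h1, hφ.nonneg T]
      · linarith [hφ.monotone h1, Real.exp_pos (p * Real.log s)]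
  have : ∫⁻ θ, ENNReal.ofReal (compLog φ ‖u θ‖) ∂circleMeasure ≤
      ∫⁻ θ, (ENNReal.ofReal (compLog (fun t => Real.exp (p * t)) ‖u θ‖) +
        ENNReal.ofReal (φ T)) ∂circleMeasure :=
    lintegral_mono fun θ => (ENNReal.ofReal_le_ofReal (hle _)).trans ENNReal.ofReal_add_le
  refine this.trans_lt ?_
  rw [lintegral_add_right' _ aemeasurable_const, lintegral_const, measure_univ, mul_one]
  exact ENNReal.add_lt_top.2 ⟨hfin, ENNReal.ofReal_lt_top⟩

theorem StronglyConvex.iUnion_hardySpace_ssubset {φ : ℝ → ℝ} (hφ : StronglyConvex φ)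
    (hexp : ∀ p : ℝ, 0 < p → ∀ᶠ t in atTop, φ t ≤ Real.exp (p * t)) :
    (⋃ p ∈ Ioi (0 : ℝ), hardySpace p) ⊂ hardyOrlicz φ := by
  obtain ⟨f, hf, hfp⟩ := hφ.exists_notMem_hardySpace hexp
  refine (ssubset_iff_of_subset (iUnion₂_subset fun p hp => hφ.hardySpace_subset (hexp p hp))).2
    ⟨f, hf, fun h => ?_⟩
  obtain ⟨p, hp, h⟩ := mem_iUnion₂.1 h
  exact hfp p hp h

end HardyOrlicz

theorem corollary5p1 :
    (∀ φ : ℝ → ℝ, HardyOrlicz.StronglyConvex φ → StrictMono φ → HardyOrlicz.HasDyadicGaps φ →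
      ∃ ψ : ℝ → ℝ, HardyOrlicz.StronglyConvex ψ ∧
        HardyOrlicz.generatedAlgebra (HardyOrlicz.hardyOrlicz ψ) ⊆
          HardyOrlicz.multipliers (HardyOrlicz.hardyOrlicz φ)) ∧
    (∀ k : ℕ, 1 ≤ k →
      (∃ φ : ℝ → ℝ, HardyOrlicz.IsExpDivIterLog k φ) ∧
      ∀ φ : ℝ → ℝ, HardyOrlicz.IsExpDivIterLog k φ →
        HardyOrlicz.HasDyadicGaps φ ∧
        (⋃ p ∈ Set.Ioi (0 : ℝ), HardyOrlicz.hardySpace p) ⊂ HardyOrlicz.hardyOrlicz φ ∧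
        ∃ ψ : ℝ → ℝ, HardyOrlicz.StronglyConvex ψ ∧
          HardyOrlicz.generatedAlgebra (HardyOrlicz.hardyOrlicz ψ) ⊆
            HardyOrlicz.multipliers (HardyOrlicz.hardyOrlicz φ) ∧
          ∃ g ∈ HardyOrlicz.hardyOrlicz ψ, ¬ ∃ C : ℝ, ∀ z : Complex.UnitDisc, ‖g z‖ ≤ C) := by
  refine ⟨fun φ hφ hm hG => hG.exists_generatedAlgebra_subset hφ hm, fun k hk =>
    ⟨HardyOrlicz.exists_isExpDivIterLog hk, fun φ h => ?_⟩⟩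
  obtain ⟨ψ, hψ, hsub⟩ := (h.hasDyadicGaps hk).exists_generatedAlgebra_subset h.1 h.2.1
  exact ⟨h.hasDyadicGaps hk, h.1.iUnion_hardySpace_ssubset h.eventually_le_exp, ψ, hψ, hsub,
    hψ.exists_unbounded⟩
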